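/- **Setting.** Let $\|\cdot\|$ denote the Euclidean norm of vectors and the spectral norm of matrices. An input is a sequence $X=[x_1,\dots,x_T]^\top\in\mathbb R^{T\times d_1}$ with a binary attention mask $a\in\{0,1\}^{T\times T}$ each of whose rows has at least one entry $1$. The masked softmax is $\mathrm{softmax}(z;a_i)_j=a_{ij}e^{z_j}/\sum_k a_{ik}e^{z_k}$. A multi-head attention (MHA) with $H$ heads, key dimension $d_K$, value dimension $d_V$ and weights $W_Q^{(j)},W_K^{(j)}\in\mathbb R^{d_1\times d_K}$, $W_V^{(j)}\in\mathbb R^{d_1\times d_V}$, $W_O^{(j)}\in\mathbb R^{d_V\times d_1}$ is $$\mathrm{Attn}(x_i)=\sum_{j=1}^H \mathrm{softmax}\Big(\tfrac{1}{\sqrt{d_K}}\,(x_i^\top W_Q^{(j)})(XW_K^{(j)})^\top;a_i\Big)\,XW_V^{(j)}W_O^{(j)} .$$ A transformer (without normalization layers) is the composition $\mathrm{Blk}^{(B)}\circ\dots\circ\mathrm{Blk}^{(1)}$ of $B$ blocks, each acting on all tokens by $$\mathrm{Blk}^{(b)}(x_i)=\mathrm{FC}^{(b)}\big(\mathrm{Attn}^{(b)}(x_i)^\top+x_i\big)+\mathrm{Attn}^{(b)}(x_i)^\top+x_i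 .$$ *Target* $f_T$: in each block the FC network is $W_L\,\mathrm{relu}(W_{L-1}\cdots\mathrm{relu}(W_1x))$ with $L$ weight matrices $W_l\in\mathbb R^{d_1\times d_1}$, the MHA has arbitrary key and value dimensions, and all MHA weight matrices $W_Q^{(j)},W_K^{(j)},W_V^{(j)},W_O^{(j)}$ and all $W_l$ have spectral norm at most $1$. *Source*: the $b$-th MHA has $H$ heads and key and value dimension $n_{\mathrm{MHA}}^{(b)}$, and the $b$-th FC network has $2L$ layers, with ReLU after every layer but the last: $\tilde W_{2L}\,\mathrm{relu}(\tilde W_{2L-1}\cdots\mathrm{relu}(\tilde W_1x))$, where $\tilde W_{2l-1}\in\mathbb R^{n_{\mathrm{FC}}^{(b)}\times d_1}$ and $\tilde W_{2l}\in\mathbb R^{d_1\times n_{\mathrm{FC}}^{(b)}}$. All weights are independent; entries of query and key matrices are uniform on $[-(n_{\mathrm{MHA}}^{(b)})^{1/4},(n_{\mathrm{MHA}}^{(b)})^{1/4}]$, and all other entries are uniform on $[-1,1]$. Pruning multiplies every weight matrix entrywise by a binary mask; the pruned source transformer is denoted $f_S$. **Theorem.** There exist a universal constant $C>0$ and universal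 quadratic polynomials $f_1,f_2,f_3,g_1,g_2,g_3$ in two variables and, for every $\alpha>0$, constants $c_1,c_2>0$ depending only on $\alpha$, such that the following holds for all $d_1,H,L\ge1$, all $B\ge2$, every target transformer as above and every $0<\epsilon<1$. Suppose that for all $b=1,\dots,B$ $$n_{\mathrm{MHA}}^{(b)}\ \ge\ d_1\,C\log\!\left(\frac{c_1^{f_1(b,B)}H^{f_2(b,B)}d_1^{f_3(b,B)}}{\epsilon}\right),\qquad n_{\mathrm{FC}}^{(b)}\ \ge\ d_1\,C\log\!\left(\frac{c_2^{g_1(b,B)}\,L\,H^{g_2(b,B)}d_1^{g_3(b,B)}}{\epsilon}\right).$$ Then, with probability at least $1-\epsilon$ over the source weights, there is a choice of binary pruning masks such that $$\max_{i\in[T]}\|f_S(x_i)-f_T(x_i)\|\le\epsilon$$ for every length $T$, every attention mask and every input $X$ with $\max_i\|x_i\|\le\alpha$. -/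

import Mathlib

open MeasureTheory ProbabilityTheory Matrix

namespace SLT

noncomputable section

/-- Euclidean norm of a vector (the default norm on `Fin d → ℝ` is the sup norm). -/
def vecNorm {d : ℕ} (v : Fin d → ℝ) : ℝ := ‖WithLp.toLp 2 v‖

open scoped Matrix.Norms.L2Operator in
/-- Spectral norm of a matrix, i.e. the operator norm for the Euclidean norms. -/
def specNorm {m n : ℕ} (A : Matrix (Fin m) (Fin n) ℝ) : ℝ := ‖A‖

/-- Coordinatewise ReLU. -/
def relu {d : ℕ} (v : Fin d → ℝ) : Fin d → ℝ := fun i => max (v i) 0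

/-- Softmax of the scores `z` restricted to the positions allowed by the attention mask `a`. -/
def softmax {T : ℕ} (z : Fin T → ℝ) (a : Fin T → Bool) : Fin T → ℝ := fun j =>
  (if a j then Real.exp (z j) else 0) / ∑ k, if a k then Real.exp (z k) else 0

/-- The weights of a multi-head attention with `H` heads, input and output dimension `d`,
key dimension `dK` and value dimension `dV`. -/
structure MHAWeights (d H dK dV : ℕ) where
  Q : Fin H → Matrix (Fin d) (Fin dK) ℝ
  K : Fin H → Matrix (Fin d) (Fin dK) ℝ
  V : Fin H → Matrix (Fin d) (Fin dV) ℝ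
  O : Fin H → Matrix (Fin dV) (Fin d) ℝ

/-- Attention output of one head at token `i`; the rows of `X` are the tokens. -/
def head {d dK dV T : ℕ} (WQ WK : Matrix (Fin d) (Fin dK) ℝ) (WV : Matrix (Fin d) (Fin dV) ℝ)
    (a : Fin T → Fin T → Bool) (X : Matrix (Fin T) (Fin d) ℝ) (i : Fin T) : Fin dV → ℝ :=
  softmax (fun k => ((X i ᵥ* WQ) ⬝ᵥ (X * WK) k) / Real.sqrt dK) (a i) ᵥ* (X * WV)

/-- Multi-head attention applied to all tokens; row `i` is the output at token `i`. -/
def attn {d H dK dV T : ℕ} (W : MHAWeights d H dK dV) (a : Fin T → Fin T → Bool)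
    (X : Matrix (Fin T) (Fin d) ℝ) : Matrix (Fin T) (Fin d) ℝ :=
  Matrix.of fun i => ∑ j, head (W.Q j) (W.K j) (W.V j) a X i ᵥ* W.O j

/-- Fully-connected ReLU network `W_L relu(W_{L-1} ⋯ relu(W_1 x))` (no activation after the
last layer). -/
def targetFC {d L : ℕ} (W : Fin L → Matrix (Fin d) (Fin d) ℝ) (x : Fin d → ℝ) : Fin d → ℝ :=
  Fin.foldl L (fun y l => if (l : ℕ) + 1 < L then relu (W l *ᵥ y) else W l *ᵥ y) x

/-- Fully-connected ReLU network with `2L` layers, whose layer widths alternate between `d` and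
`n`: `U` holds the odd layers, `V` the even ones, and ReLU follows every layer but the last. -/
def sourceFC {d n L : ℕ} (U : Fin L → Matrix (Fin n) (Fin d) ℝ)
    (V : Fin L → Matrix (Fin d) (Fin n) ℝ) (x : Fin d → ℝ) : Fin d → ℝ :=
  Fin.foldl L (fun y l =>
    if (l : ℕ) + 1 < L then relu (V l *ᵥ relu (U l *ᵥ y)) else V l *ᵥ relu (U l *ᵥ y)) x

/-- Transformer block without normalization: `x_i ↦ F(attn(x_i) + x_i) + attn(x_i) + x_i`. -/
def block {d H dK dV T : ℕ} (W : MHAWeights d H dK dV) (F : (Fin d → ℝ) → Fin d → ℝ)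
    (a : Fin T → Fin T → Bool) (X : Matrix (Fin T) (Fin d) ℝ) : Matrix (Fin T) (Fin d) ℝ :=
  Matrix.of fun i => F ((attn W a X + X) i) + (attn W a X + X) i

/-- Target transformer: the blocks are applied in the order `b = 0, …, B - 1`. -/
def targetTransformer {d H L B T : ℕ} {dK dV : Fin B → ℕ}
    (A : (b : Fin B) → MHAWeights d H (dK b) (dV b))
    (W : Fin B → Fin L → Matrix (Fin d) (Fin d) ℝ)
    (a : Fin T → Fin T → Bool) (X : Matrix (Fin T) (Fin d) ℝ) : Matrix (Fin T) (Fin d) ℝ :=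
  Fin.foldl B (fun Y b => block (A b) (targetFC (W b)) a Y) X

/-- Index set of all scalar weights of a source transformer with `B` blocks, `H` heads per
attention, embedding dimension `d`, `2L` layers per fully-connected network, key and value
dimension `nMHA b` and fully-connected hidden dimension `nFC b` in block `b`. -/
inductive WeightIdx (d H L B : ℕ) (nMHA nFC : Fin B → ℕ) : Type
  | query (b : Fin B) (j : Fin H) (i : Fin d) (k : Fin (nMHA b))
  | key (b : Fin B) (j : Fin H) (i : Fin d) (k : Fin (nMHA b))
  | value (b : Fin B) (j : Fin H) (i : Fin d) (k : Fin (nMHA b))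
  | out (b : Fin B) (j : Fin H) (k : Fin (nMHA b)) (i : Fin d)
  | fcOdd (b : Fin B) (l : Fin L) (k : Fin (nFC b)) (i : Fin d)
  | fcEven (b : Fin B) (l : Fin L) (i : Fin d) (k : Fin (nFC b))
  deriving Fintype

variable {d H L B : ℕ} {nMHA nFC : Fin B → ℕ}

/-- Attention weights of block `b` of a source transformer. -/
def sourceMHA (w : WeightIdx d H L B nMHA nFC → ℝ) (b : Fin B) :
    MHAWeights d H (nMHA b) (nMHA b) where
  Q j := Matrix.of fun i k => w (.query b j i k)
  K j := Matrix.of fun i k => w (.key b j i k)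
  V j := Matrix.of fun i k => w (.value b j i k)
  O j := Matrix.of fun k i => w (.out b j k i)

/-- Source transformer with weights `w`. -/
def sourceTransformer {T : ℕ} (w : WeightIdx d H L B nMHA nFC → ℝ)
    (a : Fin T → Fin T → Bool) (X : Matrix (Fin T) (Fin d) ℝ) : Matrix (Fin T) (Fin d) ℝ :=
  Fin.foldl B (fun Y b => block (sourceMHA w b)
    (sourceFC (fun l => Matrix.of fun k i => w (.fcOdd b l k i))
      (fun l => Matrix.of fun i k => w (.fcEven b l i k))) a Y) X

/-- The entrywise product of the weights with a binary mask. -/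
def prune {ι : Type*} (w : ι → ℝ) (m : ι → Bool) : ι → ℝ := fun e => if m e then w e else 0

/-- Half-width of the interval from which a source weight is drawn: `n_MHA^{1/4}` for query and
key weights, `1` for all others. -/
def initRadius : WeightIdx d H L B nMHA nFC → ℝ
  | .query b _ _ _ => (nMHA b : ℝ) ^ (1 / 4 : ℝ)
  | .key b _ _ _ => (nMHA b : ℝ) ^ (1 / 4 : ℝ)
  | _ => 1

/-- Random initialization: independent weights, each uniform on `[-r, r]` with `r` its
`initRadius`. -/
def initMeasure (d H L B : ℕ) (nMHA nFC : Fin B → ℕ) :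
    Measure (WeightIdx d H L B nMHA nFC → ℝ) :=
  Measure.pi fun e => volume[|Set.Icc (-initRadius e) (initRadius e)]

/-- `f` is a polynomial function of degree exactly two in `b` and `B`. -/
def IsQuadratic (f : ℝ → ℝ → ℝ) : Prop :=
  ∃ p₁ p₂ p₃ p₄ p₅ p₆ : ℝ, ¬(p₁ = 0 ∧ p₂ = 0 ∧ p₃ = 0) ∧
    ∀ b B, f b B = p₁ * b ^ 2 + p₂ * (b * B) + p₃ * B ^ 2 + p₄ * b + p₅ * B + p₆

end

end SLT

namespace SLT

noncomputable section

/-! The proof combines a random subset sum theorem with deterministic stability estimates.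

For independent samples whose laws dominate an eighth of Lebesgue measure on [-1/2, 1/2], the set of
points within reach of a subset sum grows quickly. The potential 1/volume - 2 contracts in mean by
the factor 31/32 per sample (`lintegral_potential_grow_le`). By Markov's inequality a number of
samples logarithmic in 1/δ therefore approximates all of [-1/4, 1/4] simultaneously, with failure
probability at most δ (`measure_not_subset_sum_weights_le`). A rectified uniform weight times an
independent uniform weight has such a law (`volume_le_map_posPart_mul`).

In a pair of consecutive random matrices, each hidden neuron can be pruned to read a single signed
input, and each output then selects a subset of the neurons reading that input. This realises
prescribed matrices entrywise (`PairApprox`). The linear version handles the products query-key and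
value-output, through which alone attention depends on its weights (`attn_apply`). The ReLU version
replaces one target layer by two source layers. Since the good event quantifies over all targets in
the unit ball, the masks depend neither on the sequence length nor on the input.

Masked softmax is Lipschitz from sup norm to ℓ¹ with a constant independent of the length, so the
error of a block is at most a power of its token bound times the incoming error
(`vecNorm_block_sub_le`). Token bounds grow like (4H)^b. Iterating over B blocks amplifies errors by
a quantity whose exponents are quadratic in B, and the logarithmic width bound absorbs it. -/

/-! ### Random subset sums by a potential argument -/

/-- The points of `[-1/4, 1/4]` that lie in `A` or in the translate of `A` by `x`. -/
def grow (A : Set ℝ) (x : ℝ) : Set ℝ := A ∪ {z ∈ Set.Icc (-1 / 4) (1 / 4) | z - x ∈ A}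

/-- Points of `[-1/4, 1/4]` reached from `[-δ, δ]` by successively adding some of the samples
`x` without leaving the interval. -/
def reach (δ : ℝ) : (m : ℕ) → (Fin m → ℝ) → Set ℝ
  | 0, _ => Set.Icc (-δ) δ
  | m + 1, x => grow (reach δ m fun k => x k.castSucc) (x (Fin.last m))

/-- A potential that vanishes on subsets of `[-1/4, 1/4]` of full measure. -/
def potential (A : Set ℝ) : ℝ := 1 / volume.real A - 2

/-- Joint measurability in samples and point yields both measurable sections and a volume that
depends measurably on the samples. -/
theorem measurableSet_uncurry_reach (δ : ℝ) (m : ℕ) :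
    MeasurableSet {p : (Fin m → ℝ) × ℝ | p.2 ∈ reach δ m p.1} := by
  induction m with
  | zero =>
    have : {p : (Fin 0 → ℝ) × ℝ | p.2 ∈ reach δ 0 p.1} = Prod.snd ⁻¹' Set.Icc (-δ) δ := by
      ext p; simp [reach]
    rw [this]
    exact measurable_snd measurableSet_Icc
  | succ m ih =>
    have h1 : Measurable fun p : (Fin (m + 1) → ℝ) × ℝ => ((fun k => p.1 k.castSucc : Fin m → ℝ), p.2) := by
      fun_prop
    have h2 : Measurable fun p : (Fin (m + 1) → ℝ) × ℝ =>
        ((fun k => p.1 k.castSucc : Fin m → ℝ), p.2 - p.1 (Fin.last m)) := by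
      fun_prop
    exact (h1 ih).union ((measurable_snd measurableSet_Icc).inter (h2 ih))

theorem measurableSet_reach (δ : ℝ) (m : ℕ) (x : Fin m → ℝ) : MeasurableSet (reach δ m x) :=
  measurable_prodMk_left (measurableSet_uncurry_reach δ m)

theorem measurable_volume_reach (δ : ℝ) (m : ℕ) :
    Measurable fun x : Fin m → ℝ => volume.real (reach δ m x) :=
  (measurable_measure_prodMk_left (measurableSet_uncurry_reach δ m)).ennreal_toReal

theorem reach_subset {δ : ℝ} (hδ : δ ≤ 1 / 4) (m : ℕ) (x : Fin m → ℝ) :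
    reach δ m x ⊆ Set.Icc (-1 / 4) (1 / 4) := by
  induction m with
  | zero => exact Set.Icc_subset_Icc (by linarith) hδ
  | succ m ih => exact Set.union_subset (ih _) (fun z hz => hz.1)

theorem Icc_subset_reach (δ : ℝ) (m : ℕ) (x : Fin m → ℝ) : Set.Icc (-δ) δ ⊆ reach δ m x := by
  induction m with
  | zero => exact subset_rfl
  | succ m ih => exact (ih _).trans Set.subset_union_left

/-- Each translation used to reach the point contributes its sample to the subset. What remains is
the starting point in [-δ, δ], which is the error. -/
theorem exists_subset_sum_of_mem_reach {δ : ℝ} (m : ℕ) (x : Fin m → ℝ) {z : ℝ}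
    (hz : z ∈ reach δ m x) : ∃ S : Finset (Fin m), |∑ k ∈ S, x k - z| ≤ δ := by
  induction m generalizing z with
  | zero => exact ⟨∅, by simpa [abs_le] using (Set.mem_Icc.1 hz)⟩
  | succ m ih =>
    rcases hz with hz | hz
    · obtain ⟨S, hS⟩ := ih _ hz
      exact ⟨S.map Fin.castSuccEmb, by simpa using hS⟩
    · obtain ⟨S, hS⟩ := ih _ hz.2
      refine ⟨insert (Fin.last m) (S.map Fin.castSuccEmb), ?_⟩
      rw [Finset.sum_insert (by simp [Fin.castSucc_ne_last])]
      rw [Finset.sum_map]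
      convert hS using 2
      simp only [Fin.coe_castSuccEmb]
      ring

theorem volume_real_grow_le {A : Set ℝ} (hA : MeasurableSet A)
    (hAI : A ⊆ Set.Icc (-1 / 4) (1 / 4)) (x : ℝ) :
    volume.real {z | z ∈ Set.Icc (-1 / 4) (1 / 4) \ A ∧ z - x ∈ A} ≤ volume.real A := by
  have h : volume ((fun z => z - x) ⁻¹' A) = volume A :=
    (measurePreserving_sub_right volume x).measure_preimage hA.nullMeasurableSet
  have h' : volume.real ((fun z => z - x) ⁻¹' A) = volume.real A :=
    congrArg ENNReal.toReal h
  rw [← h']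
  refine measureReal_mono (fun z hz => hz.2) ?_
  rw [h]
  exact ((measure_mono hAI).trans_lt (by simp)).ne

theorem volume_real_grow {A : Set ℝ} (hA : MeasurableSet A)
    (hAI : A ⊆ Set.Icc (-1 / 4) (1 / 4)) (x : ℝ) :
    volume.real (grow A x) = volume.real A +
      volume.real {z | z ∈ Set.Icc (-1 / 4) (1 / 4) \ A ∧ z - x ∈ A} := by
  have hfin : ∀ s ⊆ Set.Icc (-1 / 4 : ℝ) (1 / 4), volume s ≠ ⊤ :=
    fun s hs => ((measure_mono hs).trans_lt (by simp)).ne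
  have hN : MeasurableSet {z | z ∈ Set.Icc (-1 / 4) (1 / 4) \ A ∧ z - x ∈ A} :=
    (measurableSet_Icc.diff hA).inter ((measurable_sub_const x) hA)
  rw [← measureReal_union (Set.disjoint_left.2 fun z hz hz' => hz'.1.2 hz) hN (hfin _ hAI)
    (hfin _ fun z hz => hz.1.1)]
  congr 1
  ext z
  simp only [grow, Set.mem_union, Set.mem_ofPred_eq, Set.mem_sdiff]
  tauto

/-- By Tonelli, integrate over the shift first. For fixed z the admissible shifts form z - A, which
has the volume of A and lies inside [-1/2, 1/2] because z and A lie in [-1/4, 1/4]. -/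
theorem lintegral_volume_translate {A : Set ℝ} (hA : MeasurableSet A)
    (hAI : A ⊆ Set.Icc (-1 / 4) (1 / 4)) :
    ∫⁻ x in Set.Icc (-1 / 2) (1 / 2),
        volume {z | z ∈ Set.Icc (-1 / 4) (1 / 4) \ A ∧ z - x ∈ A} =
      volume A * volume (Set.Icc (-1 / 4) (1 / 4) \ A) := by
  have hS : MeasurableSet {p : ℝ × ℝ | p.2 ∈ Set.Icc (-1 / 4) (1 / 4) \ A ∧ p.2 - p.1 ∈ A} :=
    (measurable_snd (measurableSet_Icc.diff hA)).inter
      ((measurable_snd.sub measurable_fst) hA)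
  have h1 := Measure.prod_apply (μ := volume.restrict (Set.Icc (-1 / 2 : ℝ) (1 / 2)))
    (ν := (volume : Measure ℝ)) hS
  have h2 := Measure.prod_apply_symm (μ := volume.restrict (Set.Icc (-1 / 2 : ℝ) (1 / 2)))
    (ν := (volume : Measure ℝ)) hS
  refine h1.symm.trans (h2.trans ?_)
  have h3 : ∀ z : ℝ, (volume.restrict (Set.Icc (-1 / 2 : ℝ) (1 / 2)))
      ((fun x => (x, z)) ⁻¹' {p : ℝ × ℝ | p.2 ∈ Set.Icc (-1 / 4) (1 / 4) \ A ∧ p.2 - p.1 ∈ A}) =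
      (Set.Icc (-1 / 4 : ℝ) (1 / 4) \ A).indicator (fun _ => volume A) z := by
    intro z
    by_cases hz : z ∈ Set.Icc (-1 / 4 : ℝ) (1 / 4) \ A
    · rw [Set.indicator_of_mem hz, Measure.restrict_apply (measurable_prodMk_right hS)]
      have h4 : ((fun x => (x, z)) ⁻¹'
          {p : ℝ × ℝ | p.2 ∈ Set.Icc (-1 / 4) (1 / 4) \ A ∧ p.2 - p.1 ∈ A}) ∩
          Set.Icc (-1 / 2) (1 / 2) = (fun x => z - x) ⁻¹' A := by
        ext x
        simp only [Set.mem_inter_iff, Set.mem_preimage, Set.mem_ofPred_eq, hz, true_and,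
          and_iff_left_iff_imp]
        intro hx
        have := hAI hx
        have := hz.1
        simp only [Set.mem_Icc] at *
        constructor <;> linarith
      rw [h4]
      exact (Measure.measurePreserving_sub_left volume z).measure_preimage hA.nullMeasurableSet
    · rw [Set.indicator_of_notMem hz]
      have : ((fun x => (x, z)) ⁻¹'
          {p : ℝ × ℝ | p.2 ∈ Set.Icc (-1 / 4) (1 / 4) \ A ∧ p.2 - p.1 ∈ A}) = ∅ := by
        ext x
        simp only [Set.mem_preimage, Set.mem_ofPred_eq, Set.mem_empty_iff_false, iff_false]
        exact fun h => hz h.1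
      rw [this, measure_empty]
  simp only [h3]
  rw [lintegral_indicator_const (measurableSet_Icc.diff hA)]

/-- By convexity: the right side is the chord of b ↦ 1/(a + b) over [0, a]. Being linear in b, it
bounds the mean potential by the mean gain alone. -/
theorem inv_add_le {a b : ℝ} (ha : 0 < a) (hb : 0 ≤ b) (hba : b ≤ a) :
    1 / (a + b) ≤ 1 / a - b / (2 * a ^ 2) := by
  rw [div_le_iff₀ (by positivity)]
  have : (1 / a - b / (2 * a ^ 2)) * (a + b) = 1 + b * (a - b) / (2 * a ^ 2) := by
    field_simp; ring
  rw [this]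
  have : 0 ≤ b * (a - b) / (2 * a ^ 2) :=
    div_nonneg (mul_nonneg hb (by linarith)) (by positivity)
  linarith

theorem potential_nonneg {A : Set ℝ} (hAI : A ⊆ Set.Icc (-1 / 4) (1 / 4))
    (ha : 0 < volume.real A) : 0 ≤ potential A := by
  have : volume.real A ≤ 1 / 2 := by
    refine (measureReal_mono hAI (by simp)).trans (by simp; norm_num)
  unfold potential
  rw [sub_nonneg, le_div_iff₀ ha]
  linarith

/-- One sample whose law dominates an eighth of Lebesgue measure on `[-1/2, 1/2]` decreases the
potential in expectation by a constant factor. -/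
theorem lintegral_potential_grow_le {A : Set ℝ} (hA : MeasurableSet A)
    (hAI : A ⊆ Set.Icc (-1 / 4) (1 / 4)) (ha : 0 < volume.real A) (ν : Measure ℝ)
    [IsProbabilityMeasure ν]
    (hν : (8⁻¹ : ENNReal) • volume.restrict (Set.Icc (-1 / 2) (1 / 2)) ≤ ν) :
    ∫⁻ x, ENNReal.ofReal (potential (grow A x)) ∂ν ≤
      ENNReal.ofReal (31 / 32) * ENNReal.ofReal (potential A) := by
  set a := volume.real A with ha_def
  set b : ℝ → ℝ := fun x =>
    volume.real {z | z ∈ Set.Icc (-1 / 4) (1 / 4) \ A ∧ z - x ∈ A} with hb_def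
  have hfin : ∀ s ⊆ Set.Icc (-1 / 4 : ℝ) (1 / 4), volume s ≠ ⊤ :=
    fun s hs => ((measure_mono hs).trans_lt (by simp)).ne
  have hS : MeasurableSet {p : ℝ × ℝ | p.2 ∈ Set.Icc (-1 / 4) (1 / 4) \ A ∧ p.2 - p.1 ∈ A} :=
    (measurable_snd (measurableSet_Icc.diff hA)).inter
      ((measurable_snd.sub measurable_fst) hA)
  have hbm' : Measurable fun x : ℝ =>
      volume {z | z ∈ Set.Icc (-1 / 4) (1 / 4) \ A ∧ z - x ∈ A} :=
    measurable_measure_prodMk_left hS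
  have hbm : Measurable b := hbm'.ennreal_toReal
  have hb0 : ∀ x, 0 ≤ b x := fun x => measureReal_nonneg
  have hba : ∀ x, b x ≤ a := fun x => volume_real_grow_le hA hAI x
  have hbi : Integrable b ν :=
    Integrable.of_bound hbm.aestronglyMeasurable a (.of_forall fun x => by
      rw [Real.norm_of_nonneg (hb0 x)]; exact hba x)
  have hint : (1 / 8) * (a * (1 / 2 - a)) ≤ ∫ x, b x ∂ν := by
    have h1 : ∫ x, b x ∂ν =
        (∫⁻ x, volume {z | z ∈ Set.Icc (-1 / 4) (1 / 4) \ A ∧ z - x ∈ A} ∂ν).toReal :=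
      integral_toReal hbm'.aemeasurable
        (.of_forall fun x => (hfin _ fun z hz => hz.1.1).lt_top)
    have h2 : (8⁻¹ : ENNReal) * (volume A * volume (Set.Icc (-1 / 4) (1 / 4) \ A)) ≤
        ∫⁻ x, volume {z | z ∈ Set.Icc (-1 / 4) (1 / 4) \ A ∧ z - x ∈ A} ∂ν := by
      rw [← lintegral_volume_translate hA hAI, ← smul_eq_mul, ← lintegral_smul_measure]
      exact lintegral_mono' hν le_rfl
    have h3 : ∫⁻ x, volume {z | z ∈ Set.Icc (-1 / 4) (1 / 4) \ A ∧ z - x ∈ A} ∂ν ≠ ⊤ := by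
      refine ((lintegral_mono (g := fun _ => volume (Set.Icc (-1 / 4 : ℝ) (1 / 4)))
        (fun x => measure_mono fun z hz => hz.1.1)).trans_lt ?_).ne
      simp
    rw [h1]
    have h4 := ENNReal.toReal_mono h3 h2
    have h5 : volume.real (Set.Icc (-1 / 4) (1 / 4) \ A) = 1 / 2 - a := by
      rw [measureReal_sdiff hAI hA (hfin _ subset_rfl)]
      rw [Real.volume_real_Icc, ← ha_def]
      norm_num
    simp only [ENNReal.toReal_mul, ENNReal.toReal_inv, ENNReal.toReal_ofNat] at h4
    change 8⁻¹ * (a * volume.real (Set.Icc (-1 / 4) (1 / 4) \ A)) ≤ _ at h4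
    rw [h5] at h4
    linarith
  have hpt : ∀ x, potential (grow A x) ≤ potential A - b x / (2 * a ^ 2) := by
    intro x
    have := inv_add_le ha (hb0 x) (hba x)
    unfold potential
    rw [volume_real_grow hA hAI x]
    change 1 / (a + b x) - 2 ≤ 1 / a - 2 - _
    linarith
  have hg0 : ∀ x, 0 ≤ potential (grow A x) := by
    intro x
    refine potential_nonneg (Set.union_subset hAI fun z hz => hz.1) ?_
    rw [volume_real_grow hA hAI x]
    have := hb0 x
    change 0 < a + b x
    linarith
  have hi : Integrable (fun x => potential A - b x / (2 * a ^ 2)) ν :=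
    (integrable_const _).sub (hbi.div_const _)
  calc ∫⁻ x, ENNReal.ofReal (potential (grow A x)) ∂ν
      ≤ ∫⁻ x, ENNReal.ofReal (potential A - b x / (2 * a ^ 2)) ∂ν :=
        lintegral_mono fun x => ENNReal.ofReal_le_ofReal (hpt x)
    _ = ENNReal.ofReal (∫ x, (potential A - b x / (2 * a ^ 2)) ∂ν) :=
        (ofReal_integral_eq_lintegral_ofReal hi (.of_forall fun x => (hg0 x).trans (hpt x))).symm
    _ ≤ ENNReal.ofReal ((31 / 32) * potential A) := by
        refine ENNReal.ofReal_le_ofReal ?_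
        rw [integral_sub (integrable_const _) (hbi.div_const _), integral_div]
        simp only [integral_const, probReal_univ, one_smul]
        -- This identity dictates the form of the potential: the lower bound on the mean gain,
        -- divided by 2a², is exactly one thirty-second of it.
        have h6 : (1 / 32) * potential A = (1 / 8) * (a * (1 / 2 - a)) / (2 * a ^ 2) := by
          unfold potential
          rw [← ha_def]
          field_simp; ring
        have h7 : (1 / 8) * (a * (1 / 2 - a)) / (2 * a ^ 2) ≤ (∫ x, b x ∂ν) / (2 * a ^ 2) := by
          gcongr
        linarith
    _ = _ := ENNReal.ofReal_mul (by norm_num)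

theorem volume_real_reach_pos {δ : ℝ} (hδ : 0 < δ) (hδ' : δ ≤ 1 / 4) (m : ℕ) (x : Fin m → ℝ) :
    0 < volume.real (reach δ m x) := by
  have h : volume.real (Set.Icc (-δ) δ) ≤ volume.real (reach δ m x) :=
    measureReal_mono (Icc_subset_reach δ m x)
      ((measure_mono (reach_subset hδ' m x)).trans_lt (by simp)).ne
  refine lt_of_lt_of_le ?_ h
  simp only [Real.volume_real_Icc]
  exact lt_max_of_lt_left (by linarith)

/-- Integrating out the last sample for fixed earlier ones gives one contraction. The initial
interval has volume 2δ and hence potential at most 1/(2δ). -/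
theorem lintegral_potential_reach_le {δ : ℝ} (hδ : 0 < δ) (hδ' : δ ≤ 1 / 4) (m : ℕ)
    (ν : Fin m → Measure ℝ) [∀ k, IsProbabilityMeasure (ν k)]
    (hν : ∀ k, (8⁻¹ : ENNReal) • volume.restrict (Set.Icc (-1 / 2) (1 / 2)) ≤ ν k) :
    ∫⁻ x, ENNReal.ofReal (potential (reach δ m x)) ∂(Measure.pi ν) ≤
      ENNReal.ofReal (31 / 32) ^ m * ENNReal.ofReal (1 / (2 * δ)) := by
  induction m with
  | zero =>
    simp only [reach, lintegral_const, measure_univ, mul_one, pow_zero, one_mul]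
    refine ENNReal.ofReal_le_ofReal ?_
    unfold potential
    rw [Real.volume_real_Icc, max_eq_left (by linarith)]
    rw [show δ - -δ = 2 * δ by ring]
    linarith
  | succ m ih =>
    have hmp := measurePreserving_piFinSuccAbove ν (Fin.last m)
    have hmeas : Measurable fun x : Fin (m + 1) → ℝ =>
        ENNReal.ofReal (potential (reach δ (m + 1) x)) := by
      have := measurable_volume_reach δ (m + 1)
      unfold potential
      fun_prop
    rw [← hmp.symm.lintegral_comp hmeas, lintegral_prod_symm]
    swap
    · exact (hmeas.comp (MeasurableEquiv.measurable _)).aemeasurable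
    have hcomp : ∀ (x : Fin m → ℝ) (t : ℝ),
        reach δ (m + 1) ((MeasurableEquiv.piFinSuccAbove (fun _ => ℝ) (Fin.last m)).symm (t, x)) =
          grow (reach δ m x) t := by
      intro x t
      simp [reach, MeasurableEquiv.piFinSuccAbove, Fin.insertNthEquiv]
    simp only [hcomp]
    calc _ ≤ ∫⁻ x, ENNReal.ofReal (31 / 32) * ENNReal.ofReal (potential (reach δ m x))
            ∂(Measure.pi fun j => ν ((Fin.last m).succAbove j)) :=
          lintegral_mono fun x => lintegral_potential_grow_le (measurableSet_reach δ m x)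
            (reach_subset hδ' m x) (volume_real_reach_pos hδ hδ' m x) _ (hν _)
      _ = ENNReal.ofReal (31 / 32) * ∫⁻ x, ENNReal.ofReal (potential (reach δ m x))
            ∂(Measure.pi fun j => ν ((Fin.last m).succAbove j)) :=
          lintegral_const_mul' _ _ ENNReal.ofReal_ne_top
      _ ≤ _ := by
          rw [pow_succ', mul_assoc]
          gcongr
          exact ih _ fun k => hν _

/-- **Random subset sum.** With high probability every point of `[-1/4, 1/4]` is close to a
subset sum of the samples. -/
theorem measure_not_subset_sum_le {δ : ℝ} (hδ : 0 < δ) (hδ' : δ ≤ 1 / 4) (m : ℕ)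
    (ν : Fin m → Measure ℝ) [∀ k, IsProbabilityMeasure (ν k)]
    (hν : ∀ k, (8⁻¹ : ENNReal) • volume.restrict (Set.Icc (-1 / 2) (1 / 2)) ≤ ν k) :
    Measure.pi ν {x | ¬ ∀ z : ℝ, |z| ≤ 1 / 4 →
        ∃ S : Finset (Fin m), |∑ k ∈ S, x k - z| ≤ 2 * δ} ≤
      ENNReal.ofReal ((31 / 32) ^ m / (8 * δ ^ 2)) := by
  have hmeas : Measurable fun x : Fin m → ℝ => ENNReal.ofReal (potential (reach δ m x)) := by
    have := measurable_volume_reach δ m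
    unfold potential
    fun_prop
  have hsub : {x : Fin m → ℝ | ¬ ∀ z : ℝ, |z| ≤ 1 / 4 →
        ∃ S : Finset (Fin m), |∑ k ∈ S, x k - z| ≤ 2 * δ} ⊆
      {x | ENNReal.ofReal (4 * δ) ≤ ENNReal.ofReal (potential (reach δ m x))} := by
    intro x hx
    simp only [Set.mem_ofPred_eq, not_forall, not_exists, not_le] at hx ⊢
    obtain ⟨z, hz, hS⟩ := hx
    rw [abs_le] at hz
    refine ENNReal.ofReal_le_ofReal ?_
    -- A missed z excludes a whole interval of length δ, taken on the side of z facing 0 so that it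
    -- stays in [-1/4, 1/4]. The reached volume is then at most 1/2 - δ, which forces the potential
    -- to be at least 4δ.
    obtain ⟨J, hJI, hJz, hJm, hJv⟩ : ∃ J ⊆ Set.Icc (-1 / 4 : ℝ) (1 / 4),
        (∀ y ∈ J, |y - z| ≤ δ) ∧ MeasurableSet J ∧ volume.real J = δ := by
      rcases le_total z 0 with h0 | h0
      · refine ⟨Set.Icc z (z + δ), Set.Icc_subset_Icc (by linarith) (by linarith), ?_,
          measurableSet_Icc, by rw [Real.volume_real_Icc, max_eq_left] <;> linarith⟩
        rintro y ⟨h1, h2⟩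
        rw [abs_le]; constructor <;> linarith
      · refine ⟨Set.Icc (z - δ) z, Set.Icc_subset_Icc (by linarith) (by linarith), ?_,
          measurableSet_Icc, by rw [Real.volume_real_Icc, max_eq_left] <;> linarith⟩
        rintro y ⟨h1, h2⟩
        rw [abs_le]; constructor <;> linarith
    have hdisj : Disjoint (reach δ m x) J := by
      refine Set.disjoint_left.2 fun y hy hyJ => ?_
      obtain ⟨S, hS'⟩ := exists_subset_sum_of_mem_reach m x hy
      have h1 := hS S
      have h2 := hJz y hyJ
      have h3 := abs_add_le (∑ k ∈ S, x k - y) (y - z)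
      rw [sub_add_sub_cancel] at h3
      linarith
    have hfin : ∀ s ⊆ Set.Icc (-1 / 4 : ℝ) (1 / 4), volume s ≠ ⊤ :=
      fun s hs => ((measure_mono hs).trans_lt (by simp)).ne
    have hle : volume.real (reach δ m x ∪ J) ≤ volume.real (Set.Icc (-1 / 4 : ℝ) (1 / 4)) :=
      measureReal_mono (Set.union_subset (reach_subset hδ' m x) hJI) (by simp)
    rw [measureReal_union hdisj hJm (hfin _ (reach_subset hδ' m x)) (hfin _ hJI), hJv,
      Real.volume_real_Icc, max_eq_left (by norm_num)] at hle
    have hpos := volume_real_reach_pos hδ hδ' m x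
    unfold potential
    rw [le_sub_iff_add_le, le_div_iff₀ hpos]
    nlinarith
  refine (measure_mono hsub).trans ?_
  -- Markov's inequality at level 4δ; together with the initial 1/(2δ) this produces the denominator
  -- 8δ².
  refine (meas_ge_le_lintegral_div hmeas.aemeasurable
    (by simpa using hδ) ENNReal.ofReal_ne_top).trans ?_
  refine (ENNReal.div_le_div_right (lintegral_potential_reach_le hδ hδ' m ν hν) _).trans ?_
  rw [← ENNReal.ofReal_pow (by norm_num), ← ENNReal.ofReal_mul (by positivity),
    ← ENNReal.ofReal_div_of_pos (by linarith)]
  refine ENNReal.ofReal_le_ofReal (le_of_eq ?_)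
  field_simp; ring

/-! ### Products of uniform weights as subset sum samples -/

theorem isProbabilityMeasure_uniform {r : ℝ} (hr : 0 < r) :
    IsProbabilityMeasure (volume[|Set.Icc (-r) r]) :=
  cond_isProbabilityMeasure_of_finite (by simpa using hr) (by simp)

/-- The rescaled variable is uniform on [-a, a]. This interval contains [-1/2, 1/2] since a ≥ 1/2,
and the density 1/(2a) is at least 1/2 since a ≤ 1. -/
theorem uniform_preimage_ge {r a : ℝ} (hr : 0 < r) (ha : 1 / 2 ≤ a) (ha' : a ≤ 1) (S : Set ℝ) :
    2⁻¹ * volume (S ∩ Set.Icc (-1 / 2) (1 / 2)) ≤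
      volume[|Set.Icc (-r) r] {v | a * (v / r) ∈ S} := by
  have ha0 : 0 < a := by linarith
  rw [cond_apply measurableSet_Icc]
  have hsub : (fun v => (a / r) * v) ⁻¹' (S ∩ Set.Icc (-1 / 2) (1 / 2)) ⊆
      Set.Icc (-r) r ∩ {v | a * (v / r) ∈ S} := by
    rintro v ⟨hv, hv'⟩
    have h : a / r * v = a * (v / r) := by ring
    simp only [h] at hv hv'
    refine ⟨?_, hv⟩
    have h1 : |a * (v / r)| ≤ 1 / 2 := abs_le.2 ⟨by linarith [hv'.1], hv'.2⟩
    rw [abs_mul, abs_of_pos ha0, abs_div, abs_of_pos hr] at h1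
    have h2 : 1 / 2 * (|v| / r) ≤ a * (|v| / r) := by gcongr
    have h3 : |v| / r ≤ 1 := by linarith
    rw [div_le_one hr] at h3
    exact abs_le.1 h3
  refine le_trans ?_ (mul_le_mul_right (measure_mono hsub) _)
  rw [Real.volume_preimage_mul_left (by positivity), ← mul_assoc]
  refine mul_le_mul_left ?_ _
  rw [Real.volume_Icc, ← ENNReal.ofReal_inv_of_pos (by linarith), ← ENNReal.ofReal_mul
    (inv_nonneg.2 (by linarith)), inv_div, abs_of_pos (by positivity)]
  rw [show (2⁻¹ : ENNReal) = ENNReal.ofReal 2⁻¹ by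
    rw [ENNReal.ofReal_inv_of_pos (by norm_num)]; simp]
  refine ENNReal.ofReal_le_ofReal ?_
  rw [show (r - -r)⁻¹ * (r / a) = 2⁻¹ * (1 / a) by
    rw [show r - -r = 2 * r by ring]; field_simp]
  have : 1 ≤ 1 / a := by rw [le_div_iff₀ ha0]; linarith
  linarith

/-- The product of the positive (or negative) part of a uniform variable with an independent
uniform variable has a law bounded below by Lebesgue measure on `[-1/2, 1/2]`. -/
theorem volume_le_map_posPart_mul {r r' : ℝ} (hr : 0 < r) (hr' : 0 < r') {s : ℝ}
    (hs : s = 1 ∨ s = -1) :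
    (8⁻¹ : ENNReal) • volume.restrict (Set.Icc (-1 / 2) (1 / 2)) ≤
      ((volume[|Set.Icc (-r) r]).prod (volume[|Set.Icc (-r') r'])).map
        (fun p => max (s * (p.1 / r)) 0 * (p.2 / r')) := by
  have := isProbabilityMeasure_uniform hr
  have := isProbabilityMeasure_uniform hr'
  rw [Measure.le_iff]
  intro S hS
  have hf : Measurable fun p : ℝ × ℝ => max (s * (p.1 / r)) 0 * (p.2 / r') := by fun_prop
  rw [Measure.map_apply hf hS, Measure.prod_apply (hf hS), Measure.smul_apply,
    Measure.restrict_apply hS, smul_eq_mul]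
  -- With probability at least 1/4 the rectified factor lies in [1/2, 1], and given this the product
  -- has density at least 1/2 on [-1/2, 1/2]. This accounts for the factor 1/8.
  set E : Set ℝ := {u | s * (u / r) ∈ Set.Icc (1 / 2) 1} with hE
  have hEm : MeasurableSet E :=
    (show Measurable fun u : ℝ => s * (u / r) by fun_prop) measurableSet_Icc
  have hEv : 4⁻¹ ≤ volume[|Set.Icc (-r) r] E := by
    obtain ⟨x, hx⟩ : ∃ x, Set.Icc x (x + r / 2) ⊆ Set.Icc (-r) r ∩ E := by
      rcases hs with rfl | rfl
      · refine ⟨r / 2, ?_⟩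
        rintro u ⟨h1, h2⟩
        refine ⟨⟨by linarith, by linarith⟩, ?_, ?_⟩
        · rw [one_mul, le_div_iff₀ hr]; linarith
        · rw [one_mul, div_le_one hr]; linarith
      · refine ⟨-r, ?_⟩
        rintro u ⟨h1, h2⟩
        refine ⟨⟨by linarith, by linarith⟩, ?_, ?_⟩
        · rw [show -1 * (u / r) = (-u) / r by ring, le_div_iff₀ hr]; linarith
        · rw [show -1 * (u / r) = (-u) / r by ring, div_le_one hr]; linarith
    rw [cond_apply measurableSet_Icc]
    refine le_trans ?_ (mul_le_mul_right (measure_mono hx) _)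
    rw [Real.volume_Icc, Real.volume_Icc, ← ENNReal.ofReal_inv_of_pos (by linarith),
      ← ENNReal.ofReal_mul (inv_nonneg.2 (by linarith))]
    rw [show (r - -r)⁻¹ * (x + r / 2 - x) = 4⁻¹ by
      rw [show r - -r = 2 * r by ring]; field_simp; norm_num [mul_comm],
      ENNReal.ofReal_inv_of_pos (by norm_num)]
    simp
  calc 8⁻¹ * volume (S ∩ Set.Icc (-1 / 2) (1 / 2))
      = (2⁻¹ * volume (S ∩ Set.Icc (-1 / 2) (1 / 2))) * 4⁻¹ := by
        rw [mul_right_comm, ← ENNReal.mul_inv (by simp) (by simp)]; norm_num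
    _ ≤ (2⁻¹ * volume (S ∩ Set.Icc (-1 / 2) (1 / 2))) * volume[|Set.Icc (-r) r] E := by gcongr
    _ = ∫⁻ _ in E, 2⁻¹ * volume (S ∩ Set.Icc (-1 / 2) (1 / 2)) ∂volume[|Set.Icc (-r) r] := by
        rw [setLIntegral_const]
    _ ≤ ∫⁻ u in E, volume[|Set.Icc (-r') r']
          (Prod.mk u ⁻¹' ((fun p : ℝ × ℝ => max (s * (p.1 / r)) 0 * (p.2 / r')) ⁻¹' S))
          ∂volume[|Set.Icc (-r) r] := by
        refine setLIntegral_mono' hEm fun u hu => ?_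
        refine (uniform_preimage_ge hr' hu.1 hu.2 S).trans (le_of_eq ?_)
        congr 1
        ext v
        have : max (s * (u / r)) 0 = s * (u / r) := max_eq_left (by linarith [hu.1])
        simp [this]
    _ ≤ _ := setLIntegral_le_lintegral _ _

/-- Functions of disjoint pairs of coordinates of a product measure are independent. -/
theorem map_pi_pair {ι : Type*} [Fintype ι] {μ : ι → Measure ℝ} [∀ e, IsProbabilityMeasure (μ e)]
    {m : ℕ} {e e' : Fin m → ι} (hinj : Function.Injective (Sum.elim e e'))
    (f : Fin m → ℝ × ℝ → ℝ) (hf : ∀ k, Measurable (f k)) :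
    (Measure.pi μ).map (fun w k => f k (w (e k), w (e' k))) =
      Measure.pi fun k => ((μ (e k)).prod (μ (e' k))).map (f k) := by
  have h1 : (Measure.pi μ).map (fun w k => w (Sum.elim e e' k)) =
      Measure.pi fun k => μ (Sum.elim e e' k) := by
    have h := (iIndepFun_pi (μ := μ) (X := fun _ => id) fun _ => aemeasurable_id).precomp hinj
    have h' := h.map_fun_eq_pi_map fun i => (measurable_pi_apply _).aemeasurable
    refine h'.trans ?_
    congr 1
    ext1 k
    exact (measurePreserving_eval μ (Sum.elim e e' k)).map_eq
  have h2 := measurePreserving_sumPiEquivProdPi (X := fun _ => ℝ) (fun k => μ (Sum.elim e e' k))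
  have h3 := (measurePreserving_arrowProdEquivProdArrow ℝ ℝ (Fin m)
    (fun k => μ (e k)) (fun k => μ (e' k))).symm
  have h4 : MeasurePreserving (fun (w : ι → ℝ) k => w (Sum.elim e e' k)) (Measure.pi μ)
      (Measure.pi fun k => μ (Sum.elim e e' k)) := ⟨by fun_prop, h1⟩
  have h5 := (h3.comp (h2.comp h4)).map_eq
  have : ∀ k, IsProbabilityMeasure (((μ (e k)).prod (μ (e' k))).map (f k)) :=
    fun k => Measure.isProbabilityMeasure_map (hf k).aemeasurable
  rw [← Measure.pi_map_pi (fun k => (hf k).aemeasurable), ← h5, Measure.map_map]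
  · rfl
  · fun_prop
  · exact (h3.comp (h2.comp h4)).measurable

/-- The random subset sum bound for the products of disjoint pairs of uniform weights. -/
theorem measure_not_subset_sum_weights_le {ι : Type*} [Fintype ι] {r : ι → ℝ} (hr : ∀ e, 0 < r e)
    {m : ℕ} {e e' : Fin m → ι} (hinj : Function.Injective (Sum.elim e e')) {s : ℝ}
    (hs : s = 1 ∨ s = -1) {δ : ℝ} (hδ : 0 < δ) (hδ' : δ ≤ 1 / 4)
    (hm : 96 * Real.log (1 / δ) ≤ m) :
    Measure.pi (fun e => volume[|Set.Icc (-r e) (r e)])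
      {w | ¬ ∀ z : ℝ, |z| ≤ 1 / 4 → ∃ S : Finset (Fin m),
        |∑ k ∈ S, max (s * (w (e k) / r (e k))) 0 * (w (e' k) / r (e' k)) - z| ≤ 2 * δ} ≤
      ENNReal.ofReal δ := by
  have hp : ∀ e, IsProbabilityMeasure (volume[|Set.Icc (-r e) (r e)]) :=
    fun e => isProbabilityMeasure_uniform (hr e)
  set f : Fin m → ℝ × ℝ → ℝ := fun k p => max (s * (p.1 / r (e k))) 0 * (p.2 / r (e' k))
  have hf : ∀ k, Measurable (f k) := fun k => by simp only [f]; fun_prop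
  have hmap := map_pi_pair (μ := fun e => volume[|Set.Icc (-r e) (r e)]) hinj f hf
  have : ∀ k, IsProbabilityMeasure (((volume[|Set.Icc (-r (e k)) (r (e k))]).prod
      (volume[|Set.Icc (-r (e' k)) (r (e' k))])).map (f k)) :=
    fun k => Measure.isProbabilityMeasure_map (hf k).aemeasurable
  have hss := measure_not_subset_sum_le hδ hδ' m
    (fun k => ((volume[|Set.Icc (-r (e k)) (r (e k))]).prod
      (volume[|Set.Icc (-r (e' k)) (r (e' k))])).map (f k))
    (fun k => volume_le_map_posPart_mul (hr _) (hr _) hs)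
  rw [← hmap] at hss
  have hmeas : Measurable fun (w : ι → ℝ) k => f k (w (e k), w (e' k)) :=
    measurable_pi_lambda _ fun k => (hf k).comp (by fun_prop)
  refine (Measure.le_map_apply hmeas.aemeasurable _).trans (hss.trans ?_)
  refine ENNReal.ofReal_le_ofReal ?_
  -- Here 96 = 3 · 32: the bound (31/32)^m ≤ exp(-m/32) yields δ³, and dividing by 8δ² still leaves
  -- at most δ.
  have h1 : ((31 : ℝ) / 32) ^ m ≤ δ ^ 3 := by
    have h2 : (31 : ℝ) / 32 ≤ Real.exp (-(1 / 32)) := by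
      have := Real.add_one_le_exp (-(1 / 32) : ℝ); linarith
    calc ((31 : ℝ) / 32) ^ m ≤ Real.exp (-(1 / 32)) ^ m := by gcongr
      _ = Real.exp (m * (-(1 / 32))) := (Real.exp_nat_mul _ _).symm
      _ ≤ Real.exp ((3 : ℕ) * Real.log δ) := by
        rw [Real.exp_le_exp]
        rw [one_div, Real.log_inv] at hm
        push_cast
        linarith
      _ = δ ^ 3 := by rw [Real.exp_nat_mul, Real.exp_log hδ]
  rw [div_le_iff₀ (by positivity)]
  nlinarith [pow_pos hδ 3]

/-! ### Pruning two random layers to prescribed matrices -/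

/-- Entrywise masking of a matrix. -/
def maskMat {m n : ℕ} (A : Matrix (Fin m) (Fin n) ℝ) (M : Fin m → Fin n → Bool) :
    Matrix (Fin m) (Fin n) ℝ := Matrix.of fun i j => if M i j then A i j else 0

/-- The two-layer network with weights `u` and `v` can be pruned so as to realise any two matrices
with entries in `[-1, 1]`, acting on positive and negative parts, up to an entrywise error `η`. -/
def PairApprox {d n : ℕ} (η : ℝ) (u : Matrix (Fin n) (Fin d) ℝ) (v : Matrix (Fin d) (Fin n) ℝ) :
    Prop :=
  ∀ P₀ N₀ : Matrix (Fin d) (Fin d) ℝ, (∀ j i, |P₀ j i| ≤ 1) → (∀ j i, |N₀ j i| ≤ 1) →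
    ∃ (mU : Fin n → Fin d → Bool) (mV : Fin d → Fin n → Bool) (P N : Matrix (Fin d) (Fin d) ℝ),
      (∀ j i, |P j i - P₀ j i| ≤ η) ∧ (∀ j i, |N j i - N₀ j i| ≤ η) ∧
      (∀ y, maskMat v mV *ᵥ relu (maskMat u mU *ᵥ y) = P *ᵥ relu y + N *ᵥ relu (-y)) ∧
      maskMat v mV * maskMat u mU = P - N

/-- The sign attached to a Boolean. -/
def sgn (s : Bool) : ℝ := if s then 1 else -1

theorem sgn_eq (s : Bool) : sgn s = 1 ∨ sgn s = -1 := by cases s <;> simp [sgn]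

/-- Hidden neurons are grouped by input i, sign s and copy q. A neuron keeps only its weight from i,
and only if that weight has sign s, so it responds to the s-part of the i-th input. Output j then
selects a subset of each group; different outputs share the neurons but have their own outgoing
weights. Subset sums cover only [-1/4, 1/4], so four copies each supply a quarter of the entry, with
total error 4 · 2δ. -/
theorem pairApprox_of_subset_sum {d n m : ℕ} {δ : ℝ} (φ : Fin d × Bool × Fin 4 × Fin m ↪ Fin n)
    (u : Matrix (Fin n) (Fin d) ℝ) (v : Matrix (Fin d) (Fin n) ℝ)
    (h : ∀ i j s q, ∀ z : ℝ, |z| ≤ 1 / 4 → ∃ S : Finset (Fin m),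
      |∑ t ∈ S, max (sgn s * u (φ (i, s, q, t)) i) 0 * v j (φ (i, s, q, t)) - z| ≤ 2 * δ) :
    PairApprox (8 * δ) u v := by
  classical
  intro P₀ N₀ hP hN
  have hz : ∀ i j (s : Bool), |(if s then P₀ j i else N₀ j i) / 4| ≤ 1 / 4 := by
    intro i j s
    rw [abs_div, abs_of_pos (by norm_num : (0 : ℝ) < 4)]
    cases s
    · simpa using div_le_div_of_nonneg_right (hN j i) (by norm_num : (0 : ℝ) ≤ 4)
    · simpa using div_le_div_of_nonneg_right (hP j i) (by norm_num : (0 : ℝ) ≤ 4)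
  choose S hS using fun i j s q => h i j s q _ (hz i j s)
  set c : Bool → Matrix (Fin d) (Fin d) ℝ := fun s => Matrix.of fun j i =>
    ∑ q, ∑ t ∈ S i j s q, max (sgn s * u (φ (i, s, q, t)) i) 0 * v j (φ (i, s, q, t)) with hc
  have hcapp : ∀ s j i, |c s j i - (if s then P₀ j i else N₀ j i)| ≤ 8 * δ := by
    intro s j i
    have : c s j i - (if s then P₀ j i else N₀ j i) = ∑ q : Fin 4,
        (∑ t ∈ S i j s q, max (sgn s * u (φ (i, s, q, t)) i) 0 * v j (φ (i, s, q, t)) -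
          (if s then P₀ j i else N₀ j i) / 4) := by
      rw [Finset.sum_sub_distrib]
      simp only [hc, Matrix.of_apply, Finset.sum_const, Finset.card_univ, Fintype.card_fin,
        nsmul_eq_mul]
      push_cast
      ring
    rw [this]
    refine (Finset.abs_sum_le_sum_abs _ _).trans ((Finset.sum_le_sum fun q _ => hS i j s q).trans ?_)
    simp only [Finset.sum_const, Finset.card_univ, Fintype.card_fin, nsmul_eq_mul]
    push_cast
    linarith
  -- A neuron whose weight has the wrong sign is switched off; it then contributes 0, as the
  -- positive part in the subset sums does.
  set mU : Fin n → Fin d → Bool := fun k i =>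
    decide (∃ s q t, φ (i, s, q, t) = k ∧ 0 < sgn s * u k i) with hmU
  set mV : Fin d → Fin n → Bool := fun j k =>
    decide (∃ i s q t, φ (i, s, q, t) = k ∧ t ∈ S i j s q) with hmV
  have hU : ∀ i s q t i', maskMat u mU (φ (i, s, q, t)) i' =
      if i' = i then sgn s * max (sgn s * u (φ (i, s, q, t)) i) 0 else 0 := by
    intro i s q t i'
    by_cases hi : i' = i
    · subst hi
      have : (mU (φ (i', s, q, t)) i' = true) ↔ 0 < sgn s * u (φ (i', s, q, t)) i' := by
        simp only [hmU, decide_eq_true_eq, EmbeddingLike.apply_eq_iff_eq, Prod.mk.injEq, true_and]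
        constructor
        · rintro ⟨s', q', t', ⟨rfl, rfl, rfl⟩, h⟩; exact h
        · intro h; exact ⟨s, q, t, ⟨rfl, rfl, rfl⟩, h⟩
      simp only [maskMat, Matrix.of_apply, if_true, this]
      split_ifs with hpos
      · rw [max_eq_left hpos.le, ← mul_assoc]
        rcases sgn_eq s with h | h <;> rw [h] <;> ring
      · rw [max_eq_right (not_lt.1 hpos), mul_zero]
    · have : mU (φ (i, s, q, t)) i' = false := by
        simp only [hmU, decide_eq_false_iff_not, EmbeddingLike.apply_eq_iff_eq, Prod.mk.injEq]
        rintro ⟨s', q', t', ⟨rfl, _⟩, _⟩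
        exact hi rfl
      simp [maskMat, this, hi]
  have hV : ∀ j i s q t, maskMat v mV j (φ (i, s, q, t)) =
      if t ∈ S i j s q then v j (φ (i, s, q, t)) else 0 := by
    intro j i s q t
    have : (mV j (φ (i, s, q, t)) = true) ↔ t ∈ S i j s q := by
      simp only [hmV, decide_eq_true_eq, EmbeddingLike.apply_eq_iff_eq, Prod.mk.injEq]
      constructor
      · rintro ⟨i', s', q', t', ⟨rfl, rfl, rfl, rfl⟩, h⟩; exact h
      · intro h; exact ⟨i, s, q, t, ⟨rfl, rfl, rfl, rfl⟩, h⟩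
    simp only [maskMat, Matrix.of_apply, this]
  have hV0 : ∀ j k, k ∉ Set.range φ → maskMat v mV j k = 0 := by
    intro j k hk
    have : mV j k = false := by
      simp only [hmV, decide_eq_false_iff_not]
      rintro ⟨i, s, q, t, h, _⟩
      exact hk ⟨_, h⟩
    simp [maskMat, this]
  have hsum : ∀ j (g : Fin n → ℝ), ∑ k, maskMat v mV j k * g k =
      ∑ i, ∑ s, ∑ q, ∑ t ∈ S i j s q, v j (φ (i, s, q, t)) * g (φ (i, s, q, t)) := by
    intro j g
    rw [← Fintype.sum_of_injective φ φ.injective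
      (fun x => maskMat v mV j (φ x) * g (φ x)) _ (fun k hk => by rw [hV0 j k hk, zero_mul])
      (fun x => rfl)]
    simp only [Fintype.sum_prod_type, hV, ite_mul, zero_mul, Finset.sum_ite_mem,
      Finset.univ_inter]
  refine ⟨mU, mV, c true, c false, fun j i => by simpa using hcapp true j i,
    fun j i => by simpa using hcapp false j i, ?_, ?_⟩
  · intro y
    ext j
    have hy : ∀ i s q t, relu (maskMat u mU *ᵥ y) (φ (i, s, q, t)) =
        max (sgn s * u (φ (i, s, q, t)) i) 0 * max (sgn s * y i) 0 := by
      intro i s q t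
      simp only [relu, Matrix.mulVec, dotProduct, hU, ite_mul, zero_mul, Finset.sum_ite_eq',
        Finset.mem_univ, if_true]
      rw [mul_assoc, mul_left_comm, mul_max_of_nonneg _ _ (le_max_right _ _), mul_zero]
    rw [Matrix.mulVec, dotProduct, hsum]
    rw [Pi.add_apply, Matrix.mulVec, Matrix.mulVec, dotProduct, dotProduct,
      ← Finset.sum_add_distrib]
    simp only [hy, Fintype.sum_bool]
    refine Finset.sum_congr rfl fun i _ => ?_
    simp only [hc, Matrix.of_apply, Finset.sum_mul, relu, sgn, Pi.neg_apply]
    refine congrArg₂ (· + ·) ?_ ?_ <;> refine Finset.sum_congr rfl fun q _ => ?_ <;>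
      refine Finset.sum_congr rfl fun t _ => ?_
    · simp; ring
    · simp; ring
  -- Without the ReLU the sign of the incoming weight survives, so the negative groups enter with a
  -- minus sign.
  · ext j i
    rw [Matrix.mul_apply, hsum]
    simp only [hU, mul_ite, mul_zero, Matrix.sub_apply]
    rw [Finset.sum_eq_single i]
    · simp only [if_true, Fintype.sum_bool, hc, Matrix.of_apply, sub_eq_add_neg,
        ← Finset.sum_neg_distrib, sgn]
      refine congrArg₂ (· + ·) ?_ ?_ <;> refine Finset.sum_congr rfl fun q _ => ?_ <;>
        refine Finset.sum_congr rfl fun t _ => ?_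
      · simp; ring
      · simp; ring
    · intro i' _ hi
      simp [Ne.symm hi]
    · simp

/-- With high probability a pair of random weight matrices can be pruned to any prescribed
matrices. -/
theorem measure_not_pairApprox_le {ι : Type*} [Fintype ι] {r : ι → ℝ} (hr : ∀ e, 0 < r e)
    {d n m : ℕ} {eU : Fin n → Fin d → ι} {eV : Fin d → Fin n → ι}
    (hU : ∀ i, Function.Injective fun k => eU k i) (hV : ∀ j, Function.Injective (eV j))
    (hUV : ∀ k i j k', eU k i ≠ eV j k') (hn : 8 * d * m ≤ n)
    {δ : ℝ} (hδ : 0 < δ) (hδ' : δ ≤ 1 / 4) (hm : 96 * Real.log (1 / δ) ≤ m) :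
    Measure.pi (fun e => volume[|Set.Icc (-r e) (r e)])
      {w | ¬ PairApprox (8 * δ) (Matrix.of fun k i => w (eU k i) / r (eU k i))
        (Matrix.of fun j k => w (eV j k) / r (eV j k))} ≤ ENNReal.ofReal (8 * d ^ 2 * δ) := by
  obtain ⟨φ⟩ : Nonempty (Fin d × Bool × Fin 4 × Fin m ↪ Fin n) := by
    apply Function.Embedding.nonempty_of_card_le
    simp only [Fintype.card_prod, Fintype.card_fin, Fintype.card_bool]
    calc d * (2 * (4 * m)) = 8 * d * m := by ring
      _ ≤ n := hn
  -- One event per input, output, sign and copy, 8d² in all. Events for different outputs share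
  -- first-layer weights, but the union bound needs no independence between them.
  set bad : Fin d × Fin d × Bool × Fin 4 → Set (ι → ℝ) := fun x =>
    {w | ¬ ∀ z : ℝ, |z| ≤ 1 / 4 → ∃ S : Finset (Fin m),
        |∑ t ∈ S, max (sgn x.2.2.1 * (w (eU (φ (x.1, x.2.2.1, x.2.2.2, t)) x.1) /
          r (eU (φ (x.1, x.2.2.1, x.2.2.2, t)) x.1))) 0 *
          (w (eV x.2.1 (φ (x.1, x.2.2.1, x.2.2.2, t))) /
          r (eV x.2.1 (φ (x.1, x.2.2.1, x.2.2.2, t)))) - z| ≤ 2 * δ} with hbad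
  have hsub : {w : ι → ℝ | ¬ PairApprox (8 * δ) (Matrix.of fun k i => w (eU k i) / r (eU k i))
        (Matrix.of fun j k => w (eV j k) / r (eV j k))} ⊆ ⋃ x, bad x := by
    intro w hw
    by_contra hcon
    simp only [Set.mem_iUnion, not_exists] at hcon
    refine hw (pairApprox_of_subset_sum φ _ _ fun i j s q => ?_)
    exact not_not.1 (hcon (i, j, s, q))
  refine (measure_mono hsub).trans ((measure_iUnion_fintype_le _ _).trans ?_)
  calc _ ≤ ∑ x : Fin d × Fin d × Bool × Fin 4, ENNReal.ofReal δ := by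
        refine Finset.sum_le_sum fun x _ => ?_
        refine measure_not_subset_sum_weights_le hr
          (e := fun t => eU (φ (x.1, x.2.2.1, x.2.2.2, t)) x.1)
          (e' := fun t => eV x.2.1 (φ (x.1, x.2.2.1, x.2.2.2, t))) ?_ (sgn_eq _) hδ hδ' hm
        refine Function.Injective.sumElim ?_ ?_ fun _ _ => hUV _ _ _ _
        · intro t t' h
          simpa using φ.injective (hU x.1 h)
        · intro t t' h
          simpa using φ.injective (hV x.2.1 h)
    _ = _ := by
        simp only [Finset.sum_const, Finset.card_univ, Fintype.card_prod, Fintype.card_fin,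
          Fintype.card_bool, nsmul_eq_mul]
        rw [ENNReal.ofReal_mul (by positivity)]
        congr 1
        rw [← ENNReal.ofReal_natCast]
        congr 1
        push_cast
        ring

/-! ### Euclidean and spectral norm estimates -/

section Norms

variable {d m n : ℕ}

theorem vecNorm_nonneg (v : Fin d → ℝ) : 0 ≤ vecNorm v := norm_nonneg _

theorem vecNorm_add_le (v w : Fin d → ℝ) : vecNorm (v + w) ≤ vecNorm v + vecNorm w := by
  unfold vecNorm
  rw [WithLp.toLp_add]
  exact norm_add_le _ _

theorem vecNorm_smul (c : ℝ) (v : Fin d → ℝ) : vecNorm (c • v) = |c| * vecNorm v := by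
  unfold vecNorm
  rw [WithLp.toLp_smul, norm_smul, Real.norm_eq_abs]

theorem vecNorm_zero : vecNorm (0 : Fin d → ℝ) = 0 := by simp [vecNorm]

theorem vecNorm_sum_le {ι : Type*} (s : Finset ι) (f : ι → Fin d → ℝ) :
    vecNorm (∑ i ∈ s, f i) ≤ ∑ i ∈ s, vecNorm (f i) :=
  Finset.le_sum_of_subadditive vecNorm vecNorm_zero.le vecNorm_add_le s f

theorem vecNorm_eq_sqrt (v : Fin d → ℝ) : vecNorm v = √(∑ i, v i ^ 2) := by
  simp [vecNorm, EuclideanSpace.norm_eq]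

theorem vecNorm_le_of_abs_le {v w : Fin d → ℝ} (h : ∀ i, |v i| ≤ |w i|) :
    vecNorm v ≤ vecNorm w := by
  rw [vecNorm_eq_sqrt, vecNorm_eq_sqrt]
  exact Real.sqrt_le_sqrt (Finset.sum_le_sum fun i _ => sq_le_sq.2 (h i))

theorem vecNorm_neg (v : Fin d → ℝ) : vecNorm (-v) = vecNorm v := by
  simp [vecNorm_eq_sqrt]

theorem abs_dotProduct_le (v w : Fin d → ℝ) : |v ⬝ᵥ w| ≤ vecNorm v * vecNorm w := by
  have h := abs_real_inner_le_norm (WithLp.toLp 2 w) (WithLp.toLp 2 v)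
  rw [EuclideanSpace.inner_toLp_toLp] at h
  simpa [vecNorm, mul_comm] using h

theorem vecNorm_mulVec_le (A : Matrix (Fin m) (Fin n) ℝ) (x : Fin n → ℝ) :
    vecNorm (A *ᵥ x) ≤ specNorm A * vecNorm x :=
  Matrix.l2_opNorm_mulVec A (WithLp.toLp 2 x)

theorem specNorm_nonneg (A : Matrix (Fin m) (Fin n) ℝ) : 0 ≤ specNorm A :=
  letI := Matrix.instL2OpNormedAddCommGroup (m := Fin m) (n := Fin n) (𝕜 := ℝ)
  norm_nonneg A

theorem specNorm_transpose (A : Matrix (Fin m) (Fin n) ℝ) : specNorm Aᵀ = specNorm A := by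
  have := Matrix.l2_opNorm_conjTranspose A
  rwa [Matrix.conjTranspose_eq_transpose_of_trivial] at this

theorem specNorm_mul_le {p : ℕ} (A : Matrix (Fin m) (Fin n) ℝ) (A' : Matrix (Fin n) (Fin p) ℝ) :
    specNorm (A * A') ≤ specNorm A * specNorm A' :=
  Matrix.l2_opNorm_mul A A'

theorem specNorm_smul (c : ℝ) (A : Matrix (Fin m) (Fin n) ℝ) :
    specNorm (c • A) = |c| * specNorm A := by
  let _ := Matrix.instL2OpNormedAddCommGroup (m := Fin m) (n := Fin n) (𝕜 := ℝ)
  let _ := Matrix.instL2OpNormedSpace (m := Fin m) (n := Fin n) (𝕜 := ℝ)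
  exact norm_smul c A

theorem vecNorm_vecMul_le (x : Fin m → ℝ) (A : Matrix (Fin m) (Fin n) ℝ) :
    vecNorm (x ᵥ* A) ≤ specNorm A * vecNorm x := by
  rw [← Matrix.mulVec_transpose, ← specNorm_transpose]
  exact vecNorm_mulVec_le _ _

theorem specNorm_le_of_forall {A : Matrix (Fin m) (Fin n) ℝ} {c : ℝ} (hc : 0 ≤ c)
    (h : ∀ x, vecNorm (A *ᵥ x) ≤ c * vecNorm x) : specNorm A ≤ c := by
  unfold specNorm
  rw [Matrix.l2_opNorm_def]
  exact ContinuousLinearMap.opNorm_le_bound _ hc fun x => h x.ofLp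

theorem specNorm_le_of_abs_le {A : Matrix (Fin d) (Fin d) ℝ} {η : ℝ} (hη : 0 ≤ η)
    (h : ∀ i j, |A i j| ≤ η) : specNorm A ≤ d * η := by
  refine specNorm_le_of_forall (by positivity) fun x => ?_
  have h1 : ∀ i, |(A *ᵥ x) i| ≤ η * √d * vecNorm x := by
    intro i
    refine (abs_dotProduct_le _ _).trans (mul_le_mul_of_nonneg_right ?_ (vecNorm_nonneg _))
    rw [vecNorm_eq_sqrt]
    calc √(∑ j, A i j ^ 2) ≤ √(∑ _j : Fin d, η ^ 2) :=
          Real.sqrt_le_sqrt (Finset.sum_le_sum fun j _ => sq_le_sq' (abs_le.1 (h i j)).1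
            (abs_le.1 (h i j)).2)
      _ = η * √d := by
          rw [Finset.sum_const, Finset.card_univ, Fintype.card_fin, nsmul_eq_mul, mul_comm,
            Real.sqrt_mul (sq_nonneg _), Real.sqrt_sq hη]
  rw [vecNorm_eq_sqrt (A *ᵥ x)]
  calc √(∑ i, (A *ᵥ x) i ^ 2) ≤ √(∑ _i : Fin d, (η * √d * vecNorm x) ^ 2) :=
        Real.sqrt_le_sqrt (Finset.sum_le_sum fun i _ => sq_le_sq' (abs_le.1 (h1 i)).1
          (abs_le.1 (h1 i)).2)
    _ = d * η * vecNorm x := by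
        have := vecNorm_nonneg x
        rw [Finset.sum_const, Finset.card_univ, Fintype.card_fin, nsmul_eq_mul,
          Real.sqrt_mul (by positivity), Real.sqrt_sq (by positivity)]
        linear_combination (η * vecNorm x) * Real.mul_self_sqrt (Nat.cast_nonneg (α := ℝ) d)

theorem abs_apply_le_specNorm (A : Matrix (Fin m) (Fin n) ℝ) (i : Fin m) (j : Fin n) :
    |A i j| ≤ specNorm A := by
  have h1 := vecNorm_mulVec_le A (Pi.single j 1)
  have h2 : vecNorm (Pi.single j (1 : ℝ)) = 1 := by
    simp [vecNorm_eq_sqrt, Pi.single_apply]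
  have h3 : |(A *ᵥ Pi.single j 1) i| ≤ vecNorm (A *ᵥ Pi.single j 1) := by
    rw [vecNorm_eq_sqrt, ← Real.sqrt_sq_eq_abs]
    exact Real.sqrt_le_sqrt (Finset.single_le_sum (f := fun i => (A *ᵥ Pi.single j 1) i ^ 2)
      (fun _ _ => sq_nonneg _) (Finset.mem_univ i))
  rw [h2, mul_one] at h1
  simp only [Matrix.mulVec_single_one, Matrix.col_apply] at h3
  exact h3.trans (by simpa using h1)

theorem vecNorm_relu_le (v : Fin d → ℝ) : vecNorm (relu v) ≤ vecNorm v :=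
  vecNorm_le_of_abs_le fun i => by
    simp only [relu]
    rw [abs_of_nonneg (le_max_right _ _)]
    exact max_le (le_abs_self _) (abs_nonneg _)

theorem vecNorm_relu_sub_relu_le (v w : Fin d → ℝ) :
    vecNorm (relu v - relu w) ≤ vecNorm (v - w) :=
  vecNorm_le_of_abs_le fun i => by
    simpa [relu] using abs_max_sub_max_le_abs (v i) (w i) 0

end Norms

/-! ### Masked softmax -/

section Softmax

variable {T : ℕ}

theorem softmax_denom_pos (z : Fin T → ℝ) {a : Fin T → Bool} (ha : ∃ j, a j = true) :
    0 < ∑ k, if a k then Real.exp (z k) else 0 := by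
  obtain ⟨j, hj⟩ := ha
  refine Finset.sum_pos' (fun k _ => ?_) ⟨j, Finset.mem_univ _, ?_⟩
  · split_ifs <;> positivity
  · rw [if_pos hj]; positivity

theorem softmax_nonneg (z : Fin T → ℝ) (a : Fin T → Bool) (j : Fin T) : 0 ≤ softmax z a j := by
  refine div_nonneg ?_ (Finset.sum_nonneg fun k _ => ?_) <;> split_ifs <;> positivity

theorem sum_softmax (z : Fin T → ℝ) {a : Fin T → Bool} (ha : ∃ j, a j = true) :
    ∑ j, softmax z a j = 1 := by
  simp only [softmax]
  rw [← Finset.sum_div, div_self (softmax_denom_pos z ha).ne']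

/-- Numerator and denominator each change by a factor of at most exp Δ. -/
theorem softmax_le_exp_mul {z z' : Fin T → ℝ} {a : Fin T → Bool} (ha : ∃ j, a j = true) {Δ : ℝ}
    (h : ∀ k, |z k - z' k| ≤ Δ) (j : Fin T) :
    softmax z a j ≤ Real.exp (2 * Δ) * softmax z' a j := by
  have h1 : ∀ {y y' : Fin T → ℝ}, (∀ k, |y k - y' k| ≤ Δ) → ∀ k,
      (if a k then Real.exp (y k) else 0) ≤ Real.exp Δ * (if a k then Real.exp (y' k) else 0) := by
    intro y y' hy k
    split_ifs
    · rw [← Real.exp_add, Real.exp_le_exp]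
      linarith [(abs_le.1 (hy k)).2]
    · simp
  have h2 : (∑ k, if a k then Real.exp (z' k) else 0) ≤
      Real.exp Δ * ∑ k, if a k then Real.exp (z k) else 0 := by
    rw [Finset.mul_sum]
    exact Finset.sum_le_sum fun k _ => h1 (fun k => by rw [abs_sub_comm]; exact h k) k
  have hz := softmax_denom_pos z ha
  have hz' := softmax_denom_pos z' ha
  have h0 : 0 ≤ if a j then Real.exp (z' j) else 0 := by split_ifs <;> positivity
  simp only [softmax]
  rw [div_le_iff₀ hz]
  calc (if a j then Real.exp (z j) else 0)
      ≤ Real.exp Δ * (if a j then Real.exp (z' j) else 0) := h1 h j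
    _ = Real.exp Δ * ((if a j then Real.exp (z' j) else 0) /
          ∑ k, if a k then Real.exp (z' k) else 0) *
          ∑ k, if a k then Real.exp (z' k) else 0 := by
        field_simp
    _ ≤ Real.exp Δ * ((if a j then Real.exp (z' j) else 0) /
          ∑ k, if a k then Real.exp (z' k) else 0) *
          (Real.exp Δ * ∑ k, if a k then Real.exp (z k) else 0) := by
        gcongr
    _ = _ := by rw [two_mul, Real.exp_add]; ring

/-- Masked softmax is Lipschitz from the sup norm to the `ℓ¹` norm. -/
theorem sum_abs_softmax_sub_le {z z' : Fin T → ℝ} {a : Fin T → Bool} (ha : ∃ j, a j = true)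
    {Δ : ℝ} (h : ∀ k, |z k - z' k| ≤ Δ) :
    ∑ j, |softmax z a j - softmax z' a j| ≤ 8 * Δ := by
  have hΔ : 0 ≤ Δ := by
    obtain ⟨j, _⟩ := ha
    exact (abs_nonneg _).trans (h j)
  have hs : ∑ j, (softmax z a j + softmax z' a j) = 2 := by
    rw [Finset.sum_add_distrib, sum_softmax z ha, sum_softmax z' ha]; norm_num
  -- For small Δ the multiplicative bound linearises through exp(2Δ) - 1 ≤ 4Δ. For large Δ the
  -- trivial ℓ¹ bound 2 suffices.
  rcases le_total Δ (1 / 2) with hle | hge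
  · have hexp : Real.exp (2 * Δ) - 1 ≤ 4 * Δ := by
      have h1 := Real.abs_exp_sub_one_sub_id_le (x := 2 * Δ) (by rw [abs_le]; constructor <;> linarith)
      have h2 := (abs_le.1 h1).2
      nlinarith
    have hp : ∀ j, |softmax z a j - softmax z' a j| ≤
        4 * Δ * (softmax z a j + softmax z' a j) := by
      intro j
      have h1 := softmax_le_exp_mul ha h j
      have h2 := softmax_le_exp_mul ha (fun k => by rw [abs_sub_comm]; exact h k) (z := z') (z' := z) j
      have h3 := softmax_nonneg z a j
      have h4 := softmax_nonneg z' a j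
      have h5 := mul_le_mul_of_nonneg_right hexp h3
      have h6 := mul_le_mul_of_nonneg_right hexp h4
      rw [abs_le]
      constructor <;> nlinarith [mul_nonneg hΔ h3, mul_nonneg hΔ h4]
    calc _ ≤ ∑ j, 4 * Δ * (softmax z a j + softmax z' a j) := Finset.sum_le_sum fun j _ => hp j
      _ = 8 * Δ := by rw [← Finset.mul_sum, hs]; ring
  · calc _ ≤ ∑ j, (softmax z a j + softmax z' a j) := Finset.sum_le_sum fun j _ => by
          have h3 := softmax_nonneg z a j
          have h4 := softmax_nonneg z' a j
          rw [abs_le]; constructor <;> linarith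
      _ ≤ 8 * Δ := by rw [hs]; linarith

end Softmax

/-! ### Stability of attention -/

section Attention

variable {d H dK dV T : ℕ}

/-- An attention head in terms of the score matrix `M` and the value matrix `N`. -/
def bilHead (M N : Matrix (Fin d) (Fin d) ℝ) (a : Fin T → Fin T → Bool)
    (X : Matrix (Fin T) (Fin d) ℝ) (i : Fin T) : Fin d → ℝ :=
  ∑ k, softmax (fun k => X i ⬝ᵥ M *ᵥ X k) (a i) k • (X k ᵥ* N)

/-- Score matrix of a head. -/
def scoreMat (W : MHAWeights d H dK dV) (j : Fin H) : Matrix (Fin d) (Fin d) ℝ :=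
  (√dK)⁻¹ • (W.Q j * (W.K j)ᵀ)

/-- Value matrix of a head. -/
def valueMat (W : MHAWeights d H dK dV) (j : Fin H) : Matrix (Fin d) (Fin d) ℝ := W.V j * W.O j

/-- Queries and keys matter only through their product, and likewise values and outputs. The inner
dimensions thus disappear, which makes source and target heads comparable as pairs of d × d
matrices. -/
theorem attn_apply (W : MHAWeights d H dK dV) (a : Fin T → Fin T → Bool)
    (X : Matrix (Fin T) (Fin d) ℝ) (i : Fin T) :
    attn W a X i = ∑ j, bilHead (scoreMat W j) (valueMat W j) a X i := by
  change ∑ j, head (W.Q j) (W.K j) (W.V j) a X i ᵥ* W.O j = _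
  refine Finset.sum_congr rfl fun j _ => ?_
  have hscore : ∀ k, (X i ᵥ* W.Q j) ⬝ᵥ (X * W.K j) k / √dK = X i ⬝ᵥ scoreMat W j *ᵥ X k := by
    intro k
    rw [scoreMat, Matrix.smul_mulVec, dotProduct_smul, smul_eq_mul, div_eq_inv_mul,
      ← Matrix.mulVec_mulVec, Matrix.mulVec_transpose, ← Matrix.dotProduct_mulVec]
    rfl
  rw [head, Matrix.vecMul_vecMul, Matrix.mul_assoc, ← Matrix.vecMul_vecMul]
  simp only [hscore, bilHead]
  ext c
  simp only [valueMat, Matrix.vecMul, dotProduct, Finset.sum_apply, Pi.smul_apply, smul_eq_mul,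
    Finset.sum_mul, Finset.mul_sum, mul_assoc]
  rw [Finset.sum_comm]

theorem specNorm_scoreMat_le {W : MHAWeights d H dK dV} {j : Fin H} (hQ : specNorm (W.Q j) ≤ 1)
    (hK : specNorm (W.K j) ≤ 1) : specNorm (scoreMat W j) ≤ 1 := by
  rw [scoreMat, specNorm_smul]
  have h1 : specNorm (W.Q j * (W.K j)ᵀ) ≤ 1 := by
    refine (specNorm_mul_le _ _).trans ?_
    rw [specNorm_transpose]
    exact mul_le_one₀ hQ (specNorm_nonneg _) hK
  have h2 : |(√(dK : ℝ))⁻¹| ≤ 1 := by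
    rw [abs_of_nonneg (by positivity)]
    -- The target key dimension may be 0, in which case the inverse of √0 is 0 by convention.
    rcases Nat.eq_zero_or_pos dK with rfl | h
    · simp
    · refine inv_le_one_of_one_le₀ (Real.one_le_sqrt.2 ?_)
      exact_mod_cast h
  exact mul_le_one₀ h2 (specNorm_nonneg _) h1

theorem specNorm_valueMat_le {W : MHAWeights d H dK dV} {j : Fin H} (hV : specNorm (W.V j) ≤ 1)
    (hO : specNorm (W.O j) ≤ 1) : specNorm (valueMat W j) ≤ 1 :=
  (specNorm_mul_le _ _).trans (mul_le_one₀ hV (specNorm_nonneg _) hO)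

theorem vecNorm_sum_smul_le {p : Fin T → ℝ} {y : Fin T → Fin d → ℝ} {R : ℝ}
    (hy : ∀ k, vecNorm (y k) ≤ R) : vecNorm (∑ k, p k • y k) ≤ (∑ k, |p k|) * R := by
  refine (vecNorm_sum_le _ _).trans ?_
  rw [Finset.sum_mul]
  refine Finset.sum_le_sum fun k _ => ?_
  rw [vecNorm_smul]
  exact mul_le_mul_of_nonneg_left (hy k) (abs_nonneg _)

theorem sum_abs_softmax (z : Fin T → ℝ) {a : Fin T → Bool} (ha : ∃ j, a j = true) :
    ∑ k, |softmax z a k| = 1 := by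
  rw [← sum_softmax z ha]
  exact Finset.sum_congr rfl fun k _ => abs_of_nonneg (softmax_nonneg z a k)

theorem vecNorm_bilHead_le {M N : Matrix (Fin d) (Fin d) ℝ} (hN : specNorm N ≤ 1)
    {a : Fin T → Fin T → Bool} {X : Matrix (Fin T) (Fin d) ℝ} {R : ℝ}
    (hX : ∀ k, vecNorm (X k) ≤ R) {i : Fin T} (ha : ∃ j, a i j = true) :
    vecNorm (bilHead M N a X i) ≤ R := by
  refine (vecNorm_sum_smul_le (R := R) fun k => ?_).trans ?_
  · have := vecNorm_vecMul_le (X k) N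
    nlinarith [hX k, vecNorm_nonneg (X k)]
  · rw [sum_abs_softmax _ ha, one_mul]

/-- Stability of a head under perturbation of its matrices and of the tokens. -/
theorem vecNorm_bilHead_sub_le {M N M' N' : Matrix (Fin d) (Fin d) ℝ} {ν R e : ℝ}
    (hM : specNorm M ≤ 1) (hN : specNorm N ≤ 1) (hM' : specNorm (M' - M) ≤ ν)
    (hN' : specNorm (N' - N) ≤ ν) (hR : 1 ≤ R) (he : e ≤ 1)
    {a : Fin T → Fin T → Bool} {X X' : Matrix (Fin T) (Fin d) ℝ}
    (hX : ∀ k, vecNorm (X k) ≤ R) (hX' : ∀ k, vecNorm (X' k - X k) ≤ e)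
    {i : Fin T} (ha : ∃ j, a i j = true) :
    vecNorm (bilHead M' N' a X' i - bilHead M N a X i) ≤ 34 * R ^ 3 * (ν + e) := by
  have hν : 0 ≤ ν := (specNorm_nonneg _).trans hM'
  have he0 : 0 ≤ e := (vecNorm_nonneg _).trans (hX' i)
  have hX2 : ∀ k, vecNorm (X' k) ≤ 2 * R := by
    intro k
    have := vecNorm_add_le (X' k - X k) (X k)
    rw [sub_add_cancel] at this
    linarith [hX k, hX' k]
  have hscore : ∀ k, |X' i ⬝ᵥ M' *ᵥ X' k - X i ⬝ᵥ M *ᵥ X k| ≤ 4 * ν * R ^ 2 + 3 * R * e := by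
    intro k
    have hdec : X' i ⬝ᵥ M' *ᵥ X' k - X i ⬝ᵥ M *ᵥ X k =
        X' i ⬝ᵥ (M' - M) *ᵥ X' k + (X' i ⬝ᵥ M *ᵥ (X' k - X k) +
          (X' i - X i) ⬝ᵥ M *ᵥ X k) := by
      rw [Matrix.sub_mulVec, Matrix.mulVec_sub, dotProduct_sub, dotProduct_sub, sub_dotProduct]
      ring
    have hb : ∀ (A : Matrix (Fin d) (Fin d) ℝ) (x y : Fin d → ℝ) (α β γ : ℝ),
        specNorm A ≤ α → vecNorm x ≤ β → vecNorm y ≤ γ → |x ⬝ᵥ A *ᵥ y| ≤ β * (α * γ) := by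
      intro A x y α β γ hα hβ hγ
      have h1 := (vecNorm_nonneg x).trans hβ
      have h2 := (specNorm_nonneg A).trans hα
      exact (abs_dotProduct_le _ _).trans (mul_le_mul hβ ((vecNorm_mulVec_le _ _).trans
        (mul_le_mul hα hγ (vecNorm_nonneg _) h2)) (vecNorm_nonneg _) h1)
    rw [hdec]
    refine (abs_add_le _ _).trans ?_
    have h1 := hb _ _ _ _ _ _ hM' (hX2 i) (hX2 k)
    have h2 := hb _ _ _ _ _ _ hM (hX2 i) (hX' k)
    have h3 := hb _ _ _ _ _ _ hM (hX' i) (hX k)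
    have h4 := abs_add_le (X' i ⬝ᵥ M *ᵥ (X' k - X k)) ((X' i - X i) ⬝ᵥ M *ᵥ X k)
    nlinarith
  set p := softmax (fun k => X i ⬝ᵥ M *ᵥ X k) (a i) with hp
  set p' := softmax (fun k => X' i ⬝ᵥ M' *ᵥ X' k) (a i) with hp'
  have hl1 : ∑ k, |p' k - p k| ≤ 8 * (4 * ν * R ^ 2 + 3 * R * e) := sum_abs_softmax_sub_le ha hscore
  -- Value matrix, tokens and softmax weights are changed one at a time. The three terms are at most
  -- 2Rν, e and 8(4νR² + 3Re)R, and 34R³(ν + e) dominates their sum since R ≥ 1.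
  have hdec : bilHead M' N' a X' i - bilHead M N a X i =
      ∑ k, p' k • (X' k ᵥ* (N' - N)) + (∑ k, p' k • ((X' k - X k) ᵥ* N) +
        ∑ k, (p' k - p k) • (X k ᵥ* N)) := by
    unfold bilHead
    rw [← hp, ← hp', ← Finset.sum_add_distrib, ← Finset.sum_add_distrib, ← Finset.sum_sub_distrib]
    refine Finset.sum_congr rfl fun k _ => ?_
    rw [Matrix.vecMul_sub, Matrix.sub_vecMul, smul_sub, smul_sub, sub_smul]
    abel
  have hb : ∀ (A : Matrix (Fin d) (Fin d) ℝ) (x : Fin d → ℝ) (α β : ℝ),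
      specNorm A ≤ α → vecNorm x ≤ β → vecNorm (x ᵥ* A) ≤ α * β := by
    intro A x α β hα hβ
    exact (vecNorm_vecMul_le _ _).trans
      (mul_le_mul hα hβ (vecNorm_nonneg _) ((specNorm_nonneg A).trans hα))
  have h1 := vecNorm_sum_smul_le (p := p') fun k => hb _ _ _ _ hN' (hX2 k)
  have h2 := vecNorm_sum_smul_le (p := p') fun k => hb _ _ _ _ hN (hX' k)
  have h3 := vecNorm_sum_smul_le (p := fun k => p' k - p k) fun k => hb _ _ _ _ hN (hX k)
  rw [hp', sum_abs_softmax _ ha, one_mul, ← hp'] at h1 h2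
  have h4 : (∑ k, |p' k - p k|) * (1 * R) ≤ 8 * (4 * ν * R ^ 2 + 3 * R * e) * R := by
    rw [one_mul]
    exact mul_le_mul_of_nonneg_right hl1 (by linarith)
  rw [hdec]
  refine (vecNorm_add_le _ _).trans ?_
  have h5 := vecNorm_add_le (∑ k, p' k • ((X' k - X k) ᵥ* N)) (∑ k, (p' k - p k) • (X k ᵥ* N))
  have hR2 : R ≤ R ^ 3 := le_self_pow₀ hR (by norm_num)
  have hR3 : R ^ 2 ≤ R ^ 3 := pow_le_pow_right₀ hR (by norm_num)
  have hR4 : 1 ≤ R ^ 3 := one_le_pow₀ hR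
  have e1 := mul_le_mul_of_nonneg_left hR2 hν
  have e2 := mul_le_mul_of_nonneg_left hR3 he0
  have e3 := mul_le_mul_of_nonneg_left hR4 he0
  have e4 : (0 : ℝ) ≤ e * R ^ 3 := by positivity
  nlinarith

theorem vecNorm_attn_le {W : MHAWeights d H dK dV} {a : Fin T → Fin T → Bool}
    {X : Matrix (Fin T) (Fin d) ℝ} {R : ℝ} (hV : ∀ j, specNorm (W.V j) ≤ 1)
    (hO : ∀ j, specNorm (W.O j) ≤ 1) (hX : ∀ k, vecNorm (X k) ≤ R) {i : Fin T}
    (ha : ∃ j, a i j = true) : vecNorm (attn W a X i) ≤ H * R := by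
  rw [attn_apply]
  refine (vecNorm_sum_le _ _).trans ((Finset.sum_le_sum fun j _ =>
    vecNorm_bilHead_le (specNorm_valueMat_le (hV j) (hO j)) hX ha).trans ?_)
  simp

theorem vecNorm_attn_sub_le {dK' dV' : ℕ} {W : MHAWeights d H dK dV} {W' : MHAWeights d H dK' dV'}
    {ν R e : ℝ} (hM : ∀ j, specNorm (scoreMat W j) ≤ 1) (hN : ∀ j, specNorm (valueMat W j) ≤ 1)
    (hM' : ∀ j, specNorm (scoreMat W' j - scoreMat W j) ≤ ν)
    (hN' : ∀ j, specNorm (valueMat W' j - valueMat W j) ≤ ν) (hR : 1 ≤ R) (he : e ≤ 1)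
    {a : Fin T → Fin T → Bool} {X X' : Matrix (Fin T) (Fin d) ℝ}
    (hX : ∀ k, vecNorm (X k) ≤ R) (hX' : ∀ k, vecNorm (X' k - X k) ≤ e)
    {i : Fin T} (ha : ∃ j, a i j = true) :
    vecNorm (attn W' a X' i - attn W a X i) ≤ H * (34 * R ^ 3 * (ν + e)) := by
  rw [attn_apply, attn_apply, ← Finset.sum_sub_distrib]
  refine (vecNorm_sum_le _ _).trans ((Finset.sum_le_sum fun j _ =>
    vecNorm_bilHead_sub_le (hM j) (hN j) (hM' j) (hN' j) hR he hX hX' ha).trans ?_)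
  simp

end Attention

/-! ### Stability of fully-connected networks -/

section FullyConnected

/-- Simultaneous induction along two folds, with an invariant that may depend on the number of steps
taken. It is applied to layers within a network and to blocks within a transformer. -/
theorem foldl_rel {α β : Type*} (n : ℕ) (f : α → Fin n → α) (g : β → Fin n → β)
    (P : ℕ → α → β → Prop) (x : α) (y : β) (h0 : P 0 x y)
    (hs : ∀ (l : Fin n) a b, P l a b → P (l + 1) (f a l) (g b l)) :
    P n (Fin.foldl n f x) (Fin.foldl n g y) := by
  induction n with
  | zero => simpa using h0
  | succ n ih =>
    rw [Fin.foldl_succ_last, Fin.foldl_succ_last]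
    exact hs (Fin.last n) _ _ (ih _ _ fun l a b h => hs l.castSucc a b h)

variable {d n L : ℕ}

theorem vecNorm_targetFC_le {W : Fin L → Matrix (Fin d) (Fin d) ℝ} (hW : ∀ l, specNorm (W l) ≤ 1)
    {x : Fin d → ℝ} {R : ℝ} (hx : vecNorm x ≤ R) : vecNorm (targetFC W x) ≤ R := by
  refine foldl_rel L _ (fun u _ => u) (fun _ (y : Fin d → ℝ) (_ : Unit) => vecNorm y ≤ R) x () hx ?_
  intro l y _ hy
  have h : vecNorm (W l *ᵥ y) ≤ R := by
    have := vecNorm_mulVec_le (W l) y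
    nlinarith [hW l, vecNorm_nonneg y]
  split_ifs
  · exact (vecNorm_relu_le _).trans h
  · exact h

/-- Stability of a fully-connected network whose layers are approximated by pairs of layers. -/
theorem vecNorm_sourceFC_sub_targetFC_le {W : Fin L → Matrix (Fin d) (Fin d) ℝ}
    {U : Fin L → Matrix (Fin n) (Fin d) ℝ} {V : Fin L → Matrix (Fin d) (Fin n) ℝ}
    (hW : ∀ l, specNorm (W l) ≤ 1) {τ : ℝ} (hτ : 0 ≤ τ) (hτL : 2 * L * τ ≤ 1)
    (hUV : ∀ l y, vecNorm (V l *ᵥ relu (U l *ᵥ y) - W l *ᵥ y) ≤ τ * vecNorm y)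
    {x x' : Fin d → ℝ} {R e : ℝ} (hx : vecNorm x ≤ R) (hx' : vecNorm (x' - x) ≤ e) :
    vecNorm (sourceFC U V x' - targetFC W x) ≤ e + 2 * L * τ * (R + e) := by
  have hR : 0 ≤ R := (vecNorm_nonneg _).trans hx
  have he : 0 ≤ e := (vecNorm_nonneg _).trans hx'
  -- The error grows linearly in depth: unit spectral norms and the 1-Lipschitz ReLU do not amplify
  -- it, while 2Lτ ≤ 1 keeps the perturbed activations below 2(R + e), so each layer adds at most
  -- 2τ(R + e).
  refine (foldl_rel L _ _ (fun l y' y => vecNorm y ≤ R ∧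
    vecNorm (y' - y) ≤ e + 2 * l * τ * (R + e)) x' x ⟨hx, by simpa using hx'⟩ ?_).2
  rintro l y' y ⟨hy, hy'⟩
  have h1 : vecNorm (W l *ᵥ y) ≤ R := by
    have := vecNorm_mulVec_le (W l) y
    nlinarith [hW l, vecNorm_nonneg y]
  have h2 : vecNorm (V l *ᵥ relu (U l *ᵥ y') - W l *ᵥ y) ≤
      e + 2 * (l + 1 : ℕ) * τ * (R + e) := by
    have h3 := vecNorm_add_le (V l *ᵥ relu (U l *ᵥ y') - W l *ᵥ y') (W l *ᵥ (y' - y))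
    rw [Matrix.mulVec_sub, sub_add_sub_cancel] at h3
    have h4 := vecNorm_mulVec_le (W l) (y' - y)
    rw [Matrix.mulVec_sub] at h4
    have h5 : specNorm (W l) * vecNorm (y' - y) ≤ vecNorm (y' - y) :=
      mul_le_of_le_one_left (vecNorm_nonneg _) (hW l)
    have h6 := vecNorm_add_le (y' - y) y
    rw [sub_add_cancel] at h6
    have h7 : 2 * (l : ℕ) * τ * (R + e) ≤ R + e := by
      refine mul_le_of_le_one_left (by linarith) (le_trans ?_ hτL)
      gcongr
      exact l.2.le
    have h8 : τ * vecNorm y' ≤ τ * (2 * (R + e)) :=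
      mul_le_mul_of_nonneg_left (by linarith) hτ
    have h9 := hUV l y'
    push_cast
    linarith
  split_ifs
  · exact ⟨(vecNorm_relu_le _).trans h1, (vecNorm_relu_sub_relu_le _ _).trans h2⟩
  · exact ⟨h1, h2⟩

end FullyConnected

/-! ### Error propagation through blocks -/

section Propagation

variable {d H L T : ℕ}

theorem vecNorm_attn_add_le {dK dV : ℕ} {W : MHAWeights d H dK dV}
    {a : Fin T → Fin T → Bool} {X : Matrix (Fin T) (Fin d) ℝ} {R : ℝ} (hH : 1 ≤ H)
    (hV : ∀ j, specNorm (W.V j) ≤ 1) (hO : ∀ j, specNorm (W.O j) ≤ 1)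
    (hX : ∀ k, vecNorm (X k) ≤ R) {i : Fin T} (ha : ∃ j, a i j = true) :
    vecNorm ((attn W a X + X) i) ≤ 2 * H * R := by
  have hR : 0 ≤ R := (vecNorm_nonneg _).trans (hX i)
  have hH' : (1 : ℝ) ≤ H := by exact_mod_cast hH
  have h1 := vecNorm_add_le (attn W a X i) (X i)
  have h2 := vecNorm_attn_le hV hO hX ha
  have h3 := hX i
  change vecNorm (attn W a X i + X i) ≤ _
  nlinarith

theorem vecNorm_block_le {dK dV : ℕ} {W : MHAWeights d H dK dV}
    {F : Fin L → Matrix (Fin d) (Fin d) ℝ}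
    {a : Fin T → Fin T → Bool} {X : Matrix (Fin T) (Fin d) ℝ} {R : ℝ} (hH : 1 ≤ H)
    (hV : ∀ j, specNorm (W.V j) ≤ 1) (hO : ∀ j, specNorm (W.O j) ≤ 1)
    (hF : ∀ l, specNorm (F l) ≤ 1)
    (hX : ∀ k, vecNorm (X k) ≤ R) {i : Fin T} (ha : ∃ j, a i j = true) :
    vecNorm (block W (targetFC F) a X i) ≤ 4 * H * R := by
  have h1 := vecNorm_attn_add_le hH hV hO hX ha
  have h2 := vecNorm_targetFC_le hF h1
  have h3 := vecNorm_add_le (targetFC F ((attn W a X + X) i)) ((attn W a X + X) i)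
  change vecNorm (targetFC F ((attn W a X + X) i) + (attn W a X + X) i) ≤ _
  linarith

/-- Error propagation through one block. -/
theorem vecNorm_block_sub_le {dK dV dK' dV' n : ℕ} {W : MHAWeights d H dK dV}
    {W' : MHAWeights d H dK' dV'} {F : Fin L → Matrix (Fin d) (Fin d) ℝ}
    {U : Fin L → Matrix (Fin n) (Fin d) ℝ} {V : Fin L → Matrix (Fin d) (Fin n) ℝ}
    {a : Fin T → Fin T → Bool} {X X' : Matrix (Fin T) (Fin d) ℝ} {R e ν τ : ℝ} (hH : 1 ≤ H)
    (hW : ∀ j, specNorm (W.Q j) ≤ 1 ∧ specNorm (W.K j) ≤ 1 ∧ specNorm (W.V j) ≤ 1 ∧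
      specNorm (W.O j) ≤ 1)
    (hF : ∀ l, specNorm (F l) ≤ 1)
    (hM' : ∀ j, specNorm (scoreMat W' j - scoreMat W j) ≤ ν)
    (hN' : ∀ j, specNorm (valueMat W' j - valueMat W j) ≤ ν)
    (hν : 0 ≤ ν) (hτ : 0 ≤ τ) (hτL : 2 * L * τ ≤ 1)
    (hUV : ∀ l y, vecNorm (V l *ᵥ relu (U l *ᵥ y) - F l *ᵥ y) ≤ τ * vecNorm y)
    (hR : 1 ≤ R) (he : e ≤ 1)
    (hX : ∀ k, vecNorm (X k) ≤ R) (hX' : ∀ k, vecNorm (X' k - X k) ≤ e)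
    {i : Fin T} (ha : ∃ j, a i j = true) :
    vecNorm (block W' (sourceFC U V) a X' i - block W (targetFC F) a X i) ≤
      105 * H * R ^ 3 * (e + (ν + 2 * L * τ)) := by
  have hH' : (1 : ℝ) ≤ H := by exact_mod_cast hH
  have he0 : 0 ≤ e := (vecNorm_nonneg _).trans (hX' i)
  have hR3 : 1 ≤ R ^ 3 := one_le_pow₀ hR
  have hR1 : R ≤ R ^ 3 := le_self_pow₀ hR (by norm_num)
  have hκ : 0 ≤ 2 * L * τ := by positivity
  have h1 : vecNorm ((attn W' a X' + X') i - (attn W a X + X) i) ≤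
      35 * H * R ^ 3 * (ν + e) := by
    have h2 := vecNorm_attn_sub_le (fun j => specNorm_scoreMat_le (hW j).1 (hW j).2.1)
      (fun j => specNorm_valueMat_le (hW j).2.2.1 (hW j).2.2.2) hM' hN' hR he hX hX' ha
    have h3 := vecNorm_add_le (attn W' a X' i - attn W a X i) (X' i - X i)
    rw [← add_sub_add_comm] at h3
    have h4 : 1 * e ≤ H * R ^ 3 * (ν + e) :=
      mul_le_mul (one_le_mul_of_one_le_of_one_le hH' hR3) (by linarith) he0 (by positivity)
    have h5 := hX' i
    change vecNorm (attn W' a X' i + X' i - (attn W a X i + X i)) ≤ _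
    linarith
  have h2 := vecNorm_sourceFC_sub_targetFC_le hF hτ hτL hUV
    (vecNorm_attn_add_le hH (fun j => (hW j).2.2.1) (fun j => (hW j).2.2.2) hX ha) h1
  have h3 := vecNorm_add_le
    (sourceFC U V ((attn W' a X' + X') i) - targetFC F ((attn W a X + X) i))
    ((attn W' a X' + X') i - (attn W a X + X) i)
  rw [← add_sub_add_comm] at h3
  -- The attention error, at most 35HR³(ν + e), is counted three times: carried through the network,
  -- multiplied by 2Lτ ≤ 1, and passed along the residual connection. Hence the constant 105.
  have h4 : 2 * L * τ * (35 * H * R ^ 3 * (ν + e)) ≤ 1 * (35 * H * R ^ 3 * (ν + e)) :=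
    mul_le_mul_of_nonneg_right hτL (by positivity)
  have h5 : 2 * L * τ * (2 * H * R) ≤ 2 * L * τ * (2 * H * R ^ 3) := by gcongr
  have h6 : 0 ≤ 2 * L * τ * (H * R ^ 3) := by positivity
  refine h3.trans ?_
  linarith

/-- Error propagation through the whole transformer. -/
theorem vecNorm_transformer_sub_le {B : ℕ} {dK dV nMHA nFC : Fin B → ℕ}
    {A : (b : Fin B) → MHAWeights d H (dK b) (dV b)} {W : Fin B → Fin L → Matrix (Fin d) (Fin d) ℝ}
    {w : WeightIdx d H L B nMHA nFC → ℝ} {ν τ α ε : ℝ} (hH : 1 ≤ H)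
    (hA : ∀ b j, specNorm ((A b).Q j) ≤ 1 ∧ specNorm ((A b).K j) ≤ 1 ∧
      specNorm ((A b).V j) ≤ 1 ∧ specNorm ((A b).O j) ≤ 1)
    (hW : ∀ b l, specNorm (W b l) ≤ 1)
    (hM : ∀ b j, specNorm (scoreMat (sourceMHA w b) j - scoreMat (A b) j) ≤ ν)
    (hN : ∀ b j, specNorm (valueMat (sourceMHA w b) j - valueMat (A b) j) ≤ ν)
    (hν : 0 ≤ ν) (hτ : 0 ≤ τ) (hτL : 2 * L * τ ≤ 1)
    (hUV : ∀ b l y, vecNorm ((Matrix.of fun i k => w (.fcEven b l i k)) *ᵥ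
      relu ((Matrix.of fun k i => w (.fcOdd b l k i)) *ᵥ y) - W b l *ᵥ y) ≤ τ * vecNorm y)
    (hα : 1 ≤ α) (hε : ε ≤ 1)
    (hG : (210 * H * ((4 * H) ^ B * α) ^ 3) ^ B * (ν + 2 * L * τ) ≤ ε)
    {a : Fin T → Fin T → Bool} {X : Matrix (Fin T) (Fin d) ℝ} (ha : ∀ i, ∃ j, a i j = true)
    (hX : ∀ i, vecNorm (X i) ≤ α) (i : Fin T) :
    vecNorm (sourceTransformer w a X i - targetTransformer A W a X i) ≤ ε := by
  have hH' : (1 : ℝ) ≤ H := by exact_mod_cast hH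
  have h4H : (1 : ℝ) ≤ 4 * H := by linarith
  set R : ℝ := (4 * H) ^ B * α with hR
  -- Twice the block factor 105HR³. The recursion then adds σ to an error bound G^b σ that is
  -- already at least σ, and this doubling is absorbed in G.
  set G : ℝ := 210 * H * R ^ 3 with hGdef
  set σ : ℝ := ν + 2 * L * τ with hσ
  have hσ0 : 0 ≤ σ := by positivity
  have hR1 : 1 ≤ R := one_le_mul_of_one_le_of_one_le (one_le_pow₀ h4H) hα
  have hR3 : 1 ≤ R ^ 3 := one_le_pow₀ hR1
  have hG1 : 1 ≤ G := one_le_mul_of_one_le_of_one_le (by linarith) hR3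
  refine ((foldl_rel B _ _ (fun b (Y' Y : Matrix (Fin T) (Fin d) ℝ) =>
    (∀ i, vecNorm (Y i) ≤ (4 * H) ^ b * α) ∧ ∀ i, vecNorm (Y' i - Y i) ≤ G ^ b * σ) X X
    ⟨by simpa using hX, fun i => by simpa [vecNorm_zero] using hσ0⟩ ?_).2 i).trans hG
  rintro b Y' Y ⟨hY, hY'⟩
  have hYR : ∀ i, vecNorm (Y i) ≤ R := fun i => (hY i).trans (by
    rw [hR]
    gcongr
    exact b.2.le)
  have he : G ^ (b : ℕ) * σ ≤ 1 := by
    refine le_trans ?_ (hG.trans hε)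
    gcongr
    exact b.2.le
  refine ⟨fun i => ?_, fun i => ?_⟩
  · refine (vecNorm_block_le hH (fun j => (hA b j).2.2.1) (fun j => (hA b j).2.2.2) (hW b) hY
      (ha i)).trans (le_of_eq ?_)
    rw [pow_succ]; ring
  · refine (vecNorm_block_sub_le hH (hA b) (hW b) (hM b) (hN b) hν hτ hτL (hUV b) hR1 he hYR hY'
      (ha i)).trans ?_
    have h1 : 1 * σ ≤ G ^ (b : ℕ) * σ := mul_le_mul_of_nonneg_right (one_le_pow₀ hG1) hσ0
    have h2 : 105 * H * R ^ 3 * (G ^ (b : ℕ) * σ + σ) ≤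
        105 * H * R ^ 3 * (G ^ (b : ℕ) * σ + G ^ (b : ℕ) * σ) := by
      gcongr
      linarith
    refine h2.trans (le_of_eq ?_)
    rw [pow_succ, hGdef]; ring

end Propagation

/-! ### Choosing the masks, and the probability that they exist -/

section Masks

variable {d n : ℕ}

theorem specNorm_sub_le_of_entries {P P₀ N N₀ M : Matrix (Fin d) (Fin d) ℝ} {η : ℝ} (hη : 0 ≤ η)
    (hP : ∀ j i, |P j i - P₀ j i| ≤ η) (hN : ∀ j i, |N j i - N₀ j i| ≤ η)
    (hM : Mᵀ = P - N) : specNorm (M - (P₀ - N₀)ᵀ) ≤ d * (2 * η) := by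
  rw [← specNorm_transpose, Matrix.transpose_sub, Matrix.transpose_transpose, hM]
  refine specNorm_le_of_abs_le (by positivity) fun j i => ?_
  have h := abs_sub (P j i - P₀ j i) (N j i - N₀ j i)
  rw [show (P - N - (P₀ - N₀)) j i = (P j i - P₀ j i) - (N j i - N₀ j i) by
    simp only [Matrix.sub_apply]; ring]
  linarith [hP j i, hN j i]

/-- Since y = relu y - relu (-y), taking W on positive parts and -W on negative parts reproduces the
linear map W. Each half contributes its own entrywise error. -/
theorem vecNorm_relu_pair_sub_le {P N W : Matrix (Fin d) (Fin d) ℝ} {η : ℝ} (hη : 0 ≤ η)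
    (hP : ∀ j i, |P j i - W j i| ≤ η) (hN : ∀ j i, |N j i - (-W) j i| ≤ η) (y : Fin d → ℝ) :
    vecNorm (P *ᵥ relu y + N *ᵥ relu (-y) - W *ᵥ y) ≤ 2 * (d * η) * vecNorm y := by
  have hy : y = relu y - relu (-y) := by
    ext i
    simp only [relu, Pi.sub_apply, Pi.neg_apply]
    rcases le_total (y i) 0 with h | h
    · rw [max_eq_right h, max_eq_left (by linarith)]; ring
    · rw [max_eq_left h, max_eq_right (by linarith)]; ring
  have hdec : P *ᵥ relu y + N *ᵥ relu (-y) - W *ᵥ y =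
      (P - W) *ᵥ relu y + (N - -W) *ᵥ relu (-y) := by
    have hWy : W *ᵥ y = W *ᵥ relu y - W *ᵥ relu (-y) := by rw [← Matrix.mulVec_sub, ← hy]
    rw [hWy, Matrix.sub_mulVec, Matrix.sub_mulVec, Matrix.neg_mulVec]
    abel
  have hb : ∀ (E : Matrix (Fin d) (Fin d) ℝ) (x : Fin d → ℝ), (∀ j i, |E j i| ≤ η) →
      vecNorm (E *ᵥ relu x) ≤ d * η * vecNorm x := fun E x hE =>
    (vecNorm_mulVec_le _ _).trans (mul_le_mul (specNorm_le_of_abs_le hη hE) (vecNorm_relu_le x)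
      (vecNorm_nonneg _) (by positivity))
  rw [hdec]
  refine (vecNorm_add_le _ _).trans ?_
  have h1 := hb (P - W) y hP
  have h2 := hb (N - -W) (-y) hN
  rw [vecNorm_neg] at h2
  linarith

variable {H L B : ℕ} {nMHA nFC : Fin B → ℕ}

/-- Every weight matrix pair of the source can be pruned to within the required precision. -/
def Prunable (δ₁ δ₂ : ℝ) (w : WeightIdx d H L B nMHA nFC → ℝ) : Prop :=
  (∀ b j, PairApprox (8 * δ₁)
    (Matrix.of fun k i => w (.query b j i k) / initRadius (WeightIdx.query b j i k :
      WeightIdx d H L B nMHA nFC))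
    (Matrix.of fun i k => w (.key b j i k) / initRadius (WeightIdx.key b j i k :
      WeightIdx d H L B nMHA nFC))) ∧
  (∀ b j, PairApprox (8 * δ₁)
    (Matrix.of fun k i => w (.value b j i k) / initRadius (WeightIdx.value b j i k :
      WeightIdx d H L B nMHA nFC))
    (Matrix.of fun i k => w (.out b j k i) / initRadius (WeightIdx.out b j k i :
      WeightIdx d H L B nMHA nFC))) ∧
  (∀ b l, PairApprox (8 * δ₂)
    (Matrix.of fun k i => w (.fcOdd b l k i) / initRadius (WeightIdx.fcOdd b l k i :
      WeightIdx d H L B nMHA nFC))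
    (Matrix.of fun i k => w (.fcEven b l i k) / initRadius (WeightIdx.fcEven b l i k :
      WeightIdx d H L B nMHA nFC)))

/-- Attention pairs use the linear half of `PairApprox` with second target 0, transposed because the
first layer there is the transposed query or value matrix. Fully-connected pairs use the ReLU half
with targets W and -W. The pairs involve disjoint weights, so their masks combine into one. -/
theorem exists_mask {δ₁ δ₂ : ℝ} (hδ₁ : 0 ≤ δ₁) (hδ₂ : 0 ≤ δ₂) (hn : ∀ b, 0 < nMHA b)
    {w : WeightIdx d H L B nMHA nFC → ℝ} (hw : Prunable δ₁ δ₂ w)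
    {dK dV : Fin B → ℕ} {A : (b : Fin B) → MHAWeights d H (dK b) (dV b)}
    {W : Fin B → Fin L → Matrix (Fin d) (Fin d) ℝ}
    (hA : ∀ b j, specNorm ((A b).Q j) ≤ 1 ∧ specNorm ((A b).K j) ≤ 1 ∧
      specNorm ((A b).V j) ≤ 1 ∧ specNorm ((A b).O j) ≤ 1)
    (hW : ∀ b l, specNorm (W b l) ≤ 1) :
    ∃ m : WeightIdx d H L B nMHA nFC → Bool,
      (∀ b j, specNorm (scoreMat (sourceMHA (prune w m) b) j - scoreMat (A b) j) ≤ 16 * d * δ₁) ∧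
      (∀ b j, specNorm (valueMat (sourceMHA (prune w m) b) j - valueMat (A b) j) ≤ 16 * d * δ₁) ∧
      ∀ b l y, vecNorm ((Matrix.of fun i k => prune w m (.fcEven b l i k)) *ᵥ
        relu ((Matrix.of fun k i => prune w m (.fcOdd b l k i)) *ᵥ y) - W b l *ᵥ y) ≤
          16 * d * δ₂ * vecNorm y := by
  obtain ⟨hqk, hvo, hfc⟩ := hw
  have hone : ∀ M : Matrix (Fin d) (Fin d) ℝ, specNorm M ≤ 1 → ∀ j i, |M j i| ≤ 1 :=
    fun M hM j i => (abs_apply_le_specNorm M j i).trans hM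
  have hzero : ∀ j i, |(0 : Matrix (Fin d) (Fin d) ℝ) j i| ≤ 1 := fun j i => by simp
  choose mQ mK P₁ N₁ hP₁ hN₁ _ hPN₁ using fun b j => hqk b j (scoreMat (A b) j)ᵀ 0
    (hone _ (by rw [specNorm_transpose]; exact specNorm_scoreMat_le (hA b j).1 (hA b j).2.1)) hzero
  choose mV mO P₂ N₂ hP₂ hN₂ _ hPN₂ using fun b j => hvo b j (valueMat (A b) j)ᵀ 0
    (hone _ (by
      rw [specNorm_transpose]; exact specNorm_valueMat_le (hA b j).2.2.1 (hA b j).2.2.2)) hzero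
  choose mF mE P₃ N₃ hP₃ hN₃ hrelu _ using fun b l => hfc b l (W b l) (-W b l)
    (hone _ (hW b l)) (fun j i => by simpa using hone _ (hW b l) j i)
  let m : WeightIdx d H L B nMHA nFC → Bool := fun e => match e with
    | .query b j i k => mQ b j k i
    | .key b j i k => mK b j i k
    | .value b j i k => mV b j k i
    | .out b j k i => mO b j i k
    | .fcOdd b l k i => mF b l k i
    | .fcEven b l i k => mE b l i k
  refine ⟨m, fun b j => ?_, fun b j => ?_, fun b l y => ?_⟩
  · have hmat : (scoreMat (sourceMHA (prune w m) b) j)ᵀ = P₁ b j - N₁ b j := by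
      rw [← hPN₁ b j]
      ext i' i
      rw [Matrix.transpose_apply, scoreMat, Matrix.smul_apply, Matrix.mul_apply, Matrix.mul_apply,
        smul_eq_mul, Finset.mul_sum]
      refine Finset.sum_congr rfl fun k _ => ?_
      have hpos : (0 : ℝ) < nMHA b := by exact_mod_cast hn b
      -- The two initialisation scales n^{1/4} multiply to √n, which cancels the attention
      -- normalisation exactly.
      have hr : ((nMHA b : ℝ) ^ (1 / 4 : ℝ)) * ((nMHA b : ℝ) ^ (1 / 4 : ℝ)) = √(nMHA b) := by
        rw [← Real.rpow_add hpos, Real.sqrt_eq_rpow]; norm_num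
      simp only [sourceMHA, prune, maskMat, Matrix.of_apply, Matrix.transpose_apply, initRadius, m]
      rw [← hr]
      split_ifs
      · field_simp
      all_goals simp
    have h := specNorm_sub_le_of_entries (by positivity) (hP₁ b j) (hN₁ b j) hmat
    rw [sub_zero, Matrix.transpose_transpose] at h
    linarith
  · have hmat : (valueMat (sourceMHA (prune w m) b) j)ᵀ = P₂ b j - N₂ b j := by
      rw [← hPN₂ b j]
      ext i' i
      rw [Matrix.transpose_apply, valueMat, Matrix.mul_apply, Matrix.mul_apply]
      refine Finset.sum_congr rfl fun k _ => ?_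
      simp only [sourceMHA, prune, maskMat, Matrix.of_apply, initRadius, m, div_one]
      rw [mul_comm]
    have h := specNorm_sub_le_of_entries (by positivity) (hP₂ b j) (hN₂ b j) hmat
    rw [sub_zero, Matrix.transpose_transpose] at h
    linarith
  · have h := vecNorm_relu_pair_sub_le (by positivity) (hP₃ b l) (hN₃ b l) y
    rw [← hrelu b l y] at h
    have hE : (Matrix.of fun i k => prune w m (.fcEven b l i k)) =
        maskMat (Matrix.of fun i k => w (.fcEven b l i k) / initRadius (WeightIdx.fcEven b l i k :
          WeightIdx d H L B nMHA nFC)) (mE b l) := by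
      ext i k
      simp [prune, maskMat, initRadius, m]
    have hF : (Matrix.of fun k i => prune w m (.fcOdd b l k i)) =
        maskMat (Matrix.of fun k i => w (.fcOdd b l k i) / initRadius (WeightIdx.fcOdd b l k i :
          WeightIdx d H L B nMHA nFC)) (mF b l) := by
      ext k i
      simp [prune, maskMat, initRadius, m]
    rw [hE, hF]
    linarith

theorem initRadius_pos (hn : ∀ b, 0 < nMHA b) (e : WeightIdx d H L B nMHA nFC) :
    0 < initRadius e := by
  have h : ∀ b, (0 : ℝ) < (nMHA b : ℝ) ^ (1 / 4 : ℝ) := fun b =>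
    Real.rpow_pos_of_pos (by exact_mod_cast hn b) _
  cases e <;> simp only [initRadius] <;> first | exact h _ | exact one_pos

theorem measure_not_prunable_le {δ₁ δ₂ : ℝ} (hδ₁ : 0 < δ₁) (hδ₁' : δ₁ ≤ 1 / 4) (hδ₂ : 0 < δ₂)
    (hδ₂' : δ₂ ≤ 1 / 4) (hn : ∀ b, 0 < nMHA b)
    (hMHA : ∀ b, ∃ m : ℕ, 8 * d * m ≤ nMHA b ∧ 96 * Real.log (1 / δ₁) ≤ m)
    (hFC : ∀ b, ∃ m : ℕ, 8 * d * m ≤ nFC b ∧ 96 * Real.log (1 / δ₂) ≤ m) :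
    initMeasure d H L B nMHA nFC {w | ¬ Prunable δ₁ δ₂ w} ≤
      ENNReal.ofReal (B * (16 * H * d ^ 2 * δ₁ + 8 * L * d ^ 2 * δ₂)) := by
  choose m₁ hm₁ hm₁' using hMHA
  choose m₂ hm₂ hm₂' using hFC
  have hr : ∀ e : WeightIdx d H L B nMHA nFC, 0 < initRadius e := initRadius_pos hn
  have hqk : ∀ b j, initMeasure d H L B nMHA nFC {w | ¬ PairApprox (8 * δ₁)
      (Matrix.of fun k i => w (.query b j i k) / initRadius (WeightIdx.query b j i k :
        WeightIdx d H L B nMHA nFC))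
      (Matrix.of fun i k => w (.key b j i k) / initRadius (WeightIdx.key b j i k :
        WeightIdx d H L B nMHA nFC))} ≤ ENNReal.ofReal (8 * d ^ 2 * δ₁) := fun b j =>
    measure_not_pairApprox_le hr (eU := fun k i => WeightIdx.query b j i k)
      (eV := fun i k => WeightIdx.key b j i k) (fun i k k' h => by simpa using h)
      (fun i k k' h => by simpa using h) (fun _ _ _ _ => by simp) (hm₁ b) hδ₁ hδ₁' (hm₁' b)
  have hvo : ∀ b j, initMeasure d H L B nMHA nFC {w | ¬ PairApprox (8 * δ₁)
      (Matrix.of fun k i => w (.value b j i k) / initRadius (WeightIdx.value b j i k :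
        WeightIdx d H L B nMHA nFC))
      (Matrix.of fun i k => w (.out b j k i) / initRadius (WeightIdx.out b j k i :
        WeightIdx d H L B nMHA nFC))} ≤ ENNReal.ofReal (8 * d ^ 2 * δ₁) := fun b j =>
    measure_not_pairApprox_le hr (eU := fun k i => WeightIdx.value b j i k)
      (eV := fun i k => WeightIdx.out b j k i) (fun i k k' h => by simpa using h)
      (fun i k k' h => by simpa using h) (fun _ _ _ _ => by simp) (hm₁ b) hδ₁ hδ₁' (hm₁' b)
  have hfc : ∀ b l, initMeasure d H L B nMHA nFC {w | ¬ PairApprox (8 * δ₂)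
      (Matrix.of fun k i => w (.fcOdd b l k i) / initRadius (WeightIdx.fcOdd b l k i :
        WeightIdx d H L B nMHA nFC))
      (Matrix.of fun i k => w (.fcEven b l i k) / initRadius (WeightIdx.fcEven b l i k :
        WeightIdx d H L B nMHA nFC))} ≤ ENNReal.ofReal (8 * d ^ 2 * δ₂) := fun b l =>
    measure_not_pairApprox_le hr (eU := fun k i => WeightIdx.fcOdd b l k i)
      (eV := fun i k => WeightIdx.fcEven b l i k) (fun i k k' h => by simpa using h)
      (fun i k k' h => by simpa using h) (fun _ _ _ _ => by simp) (hm₂ b) hδ₂ hδ₂' (hm₂' b)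
  have hsub : ∀ (f : Fin B × Fin H → Set (WeightIdx d H L B nMHA nFC → ℝ))
      (g : Fin B × Fin H → Set (WeightIdx d H L B nMHA nFC → ℝ))
      (h : Fin B × Fin L → Set (WeightIdx d H L B nMHA nFC → ℝ)),
      (∀ x, initMeasure d H L B nMHA nFC (f x) ≤ ENNReal.ofReal (8 * d ^ 2 * δ₁)) →
      (∀ x, initMeasure d H L B nMHA nFC (g x) ≤ ENNReal.ofReal (8 * d ^ 2 * δ₁)) →
      (∀ x, initMeasure d H L B nMHA nFC (h x) ≤ ENNReal.ofReal (8 * d ^ 2 * δ₂)) →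
      initMeasure d H L B nMHA nFC ((⋃ x, f x) ∪ ((⋃ x, g x) ∪ ⋃ x, h x)) ≤
        ENNReal.ofReal (B * (16 * H * d ^ 2 * δ₁ + 8 * L * d ^ 2 * δ₂)) := by
    intro f g h hf hg hh
    have hsum : ∀ (K : ℕ) (δ : ℝ) (q : Fin B × Fin K → Set (WeightIdx d H L B nMHA nFC → ℝ)),
        0 < δ → (∀ x, initMeasure d H L B nMHA nFC (q x) ≤ ENNReal.ofReal (8 * d ^ 2 * δ)) →
        initMeasure d H L B nMHA nFC (⋃ x, q x) ≤ ENNReal.ofReal (B * (8 * K * d ^ 2 * δ)) := by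
      intro K δ q hδ hq
      refine (measure_iUnion_fintype_le _ _).trans ((Finset.sum_le_sum fun x _ => hq x).trans
        (le_of_eq ?_))
      rw [Finset.sum_const, Finset.card_univ, nsmul_eq_mul, ← ENNReal.ofReal_natCast,
        ← ENNReal.ofReal_mul (by positivity)]
      congr 1
      simp only [Fintype.card_prod, Fintype.card_fin]
      push_cast
      ring
    refine (measure_union_le _ _).trans ((add_le_add (hsum H δ₁ f hδ₁ hf)
      ((measure_union_le _ _).trans (add_le_add (hsum H δ₁ g hδ₁ hg) (hsum L δ₂ h hδ₂ hh)))).trans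
      (le_of_eq ?_))
    rw [← ENNReal.ofReal_add (by positivity) (by positivity),
      ← ENNReal.ofReal_add (by positivity) (by positivity)]
    congr 1
    ring
  refine le_trans (measure_mono ?_) (hsub _ _ _ (fun x => hqk x.1 x.2) (fun x => hvo x.1 x.2)
    (fun x => hfc x.1 x.2))
  intro w hw
  by_contra hcon
  simp only [Set.mem_union, Set.mem_iUnion, Set.mem_ofPred_eq, not_or, not_exists, not_not,
    Prod.forall] at hcon
  exact hw hcon

end Masks

/-! ### Width bounds and constants -/

/-- The constant is 800 = 8 · 100. Rounding the quotient down loses less than 1 ≤ log x, which the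
slack between 100 log x and 96 log x covers. -/
theorem exists_groupSize {d n : ℕ} (hd : 1 ≤ d) {x : ℝ} (hx : 3 ≤ x)
    (hn : (n : ℝ) ≥ d * 800 * Real.log x) :
    ∃ m : ℕ, 8 * d * m ≤ n ∧ 96 * Real.log x ≤ m := by
  have hlog : 1 ≤ Real.log x := by
    rw [Real.le_log_iff_exp_le (by linarith)]
    exact (Real.exp_one_lt_three.le).trans hx
  refine ⟨n / (8 * d), Nat.mul_div_le _ _, ?_⟩
  have h1 : n < 8 * d * (n / (8 * d) + 1) := Nat.lt_mul_div_succ n (by omega)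
  have h2 : (n : ℝ) < 8 * d * ((n / (8 * d) : ℕ) + 1) := by exact_mod_cast h1
  have hd' : (1 : ℝ) ≤ d := by exact_mod_cast hd
  have h3 : (8 * d : ℝ) * (100 * Real.log x) < 8 * d * ((n / (8 * d) : ℕ) + 1) := by linarith
  have h4 := lt_of_mul_lt_mul_left h3 (by positivity)
  linarith

/-- The exponential factor in the width bound dominates the number of union-bound events. -/
theorem card_events_le {H d B : ℕ} {c : ℝ} (hH : 1 ≤ H) (hd : 1 ≤ d) (hB : 1 ≤ B)
    (hc : 210 ≤ c) : 24 * B * H * d ^ 2 ≤ (c * H * d) ^ (6 * B ^ 2) := by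
  have hH' : (1 : ℝ) ≤ H := by exact_mod_cast hH
  have hd' : (1 : ℝ) ≤ d := by exact_mod_cast hd
  have hHd : (1 : ℝ) ≤ H * d := one_le_mul_of_one_le_of_one_le hH' hd'
  have hcd : c ≤ c * H * d := by nlinarith
  have hB2 : (B : ℝ) ≤ (c * H * d) ^ B := by
    have : (B : ℝ) ≤ 2 ^ B := by exact_mod_cast Nat.lt_two_pow_self.le
    refine this.trans ?_
    gcongr
    linarith
  have h2 : 24 * H * d ^ 2 ≤ (c * H * d) ^ 2 := by
    have : (24 : ℝ) * H * d ^ 2 ≤ c ^ 2 * H ^ 2 * d ^ 2 := by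
      gcongr
      · nlinarith
      · nlinarith
    refine this.trans (le_of_eq (by ring))
  have h1 : 1 ≤ c * H * d := by linarith
  calc (24 * B * H * d ^ 2 : ℝ) = B * (24 * H * d ^ 2) := by ring
    _ ≤ (c * H * d) ^ B * (c * H * d) ^ 2 := by gcongr
    _ = (c * H * d) ^ (B + 2) := (pow_add _ _ _).symm
    _ ≤ (c * H * d) ^ (6 * B ^ 2) := pow_le_pow_right₀ h1 (by nlinarith)

/-- The exponential factor in the width bound dominates the amplification of errors. -/
theorem amplification_le {H d B : ℕ} {α : ℝ} (hα : 1 ≤ α) (hH : 1 ≤ H) (hd : 1 ≤ d)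
    (hB : 1 ≤ B) :
    (210 * H * ((4 * H) ^ B * α) ^ 3) ^ B * (48 * d) ≤ (210 * α ^ 3 * H * d) ^ (6 * B ^ 2) := by
  set c : ℝ := 210 * α ^ 3 with hc
  have hα3 : 1 ≤ α ^ 3 := one_le_pow₀ hα
  have hc1 : 210 ≤ c := by linarith
  have hH' : (1 : ℝ) ≤ H := by exact_mod_cast hH
  have hd' : (1 : ℝ) ≤ d := by exact_mod_cast hd
  have hHd : (1 : ℝ) ≤ H * d := one_le_mul_of_one_le_of_one_le hH' hd'
  have hcd : c ≤ c * H * d := by nlinarith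
  have hcH : c * H ≤ c * H * d := le_mul_of_one_le_right (by positivity) hd'
  have h1 : 1 ≤ c * H * d := by linarith
  have hG : 210 * H * ((4 * H) ^ B * α) ^ 3 ≤ (c * H * d) ^ (4 * B) := by
    calc 210 * H * ((4 * H) ^ B * α) ^ 3 = (c * H) * (4 * H) ^ (3 * B) := by
          rw [hc, mul_pow, ← pow_mul, mul_comm B 3]; ring
      _ ≤ (c * H * d) * (c * H * d) ^ (3 * B) := by
          have : 4 * (H : ℝ) ≤ c * H * d := le_trans (by gcongr; linarith) hcH
          gcongr
      _ = (c * H * d) ^ (3 * B + 1) := (pow_succ' _ _).symm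
      _ ≤ _ := pow_le_pow_right₀ h1 (by omega)
  have h2 : 48 * (d : ℝ) ≤ c * H * d := by
    have : 48 ≤ c * H := by nlinarith
    gcongr
  -- The per-block factor is at most the 4B-th power of the base. Raising it to the B-th power and
  -- adding one more factor for 48d gives exponent 4B² + 1 ≤ 6B².
  calc (210 * H * ((4 * H) ^ B * α) ^ 3) ^ B * (48 * d)
      ≤ ((c * H * d) ^ (4 * B)) ^ B * (c * H * d) := by gcongr
    _ = (c * H * d) ^ (4 * B * B + 1) := by rw [← pow_mul, pow_succ]
    _ ≤ _ := pow_le_pow_right₀ h1 (by nlinarith)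

theorem isQuadratic_six_mul_sq : IsQuadratic fun _ B => 6 * B ^ 2 :=
  ⟨0, 0, 6, 0, 0, 0, by norm_num, fun b B => by ring⟩

end

end SLT

/-! ### Assembly of the theorem -/

theorem mainTheorem2 :
    ∃ (C : ℝ) (f₁ f₂ f₃ g₁ g₂ g₃ : ℝ → ℝ → ℝ), 0 < C ∧
      SLT.IsQuadratic f₁ ∧ SLT.IsQuadratic f₂ ∧ SLT.IsQuadratic f₃ ∧
      SLT.IsQuadratic g₁ ∧ SLT.IsQuadratic g₂ ∧ SLT.IsQuadratic g₃ ∧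
      ∀ α : ℝ, 0 < α → ∃ c₁ c₂ : ℝ, 0 < c₁ ∧ 0 < c₂ ∧
        ∀ (d H L B : ℕ), 1 ≤ d → 1 ≤ H → 1 ≤ L → 2 ≤ B →
        ∀ (dK dV : Fin B → ℕ)
          (A : (b : Fin B) → SLT.MHAWeights d H (dK b) (dV b))
          (W : Fin B → Fin L → Matrix (Fin d) (Fin d) ℝ),
          (∀ b j, SLT.specNorm ((A b).Q j) ≤ 1 ∧ SLT.specNorm ((A b).K j) ≤ 1 ∧
            SLT.specNorm ((A b).V j) ≤ 1 ∧ SLT.specNorm ((A b).O j) ≤ 1) →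
          (∀ b l, SLT.specNorm (W b l) ≤ 1) →
        ∀ ε : ℝ, 0 < ε → ε < 1 →
        ∀ nMHA nFC : Fin B → ℕ,
          (∀ b : Fin B, (nMHA b : ℝ) ≥ d * C * Real.log
            (c₁ ^ f₁ ((b : ℕ) + 1) B * (H : ℝ) ^ f₂ ((b : ℕ) + 1) B
              * (d : ℝ) ^ f₃ ((b : ℕ) + 1) B / ε)) →
          (∀ b : Fin B, (nFC b : ℝ) ≥ d * C * Real.log
            (c₂ ^ g₁ ((b : ℕ) + 1) B * L * (H : ℝ) ^ g₂ ((b : ℕ) + 1) B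
              * (d : ℝ) ^ g₃ ((b : ℕ) + 1) B / ε)) →
          ENNReal.ofReal (1 - ε) ≤ SLT.initMeasure d H L B nMHA nFC
            {w | ∃ m : SLT.WeightIdx d H L B nMHA nFC → Bool,
              ∀ (T : ℕ) (a : Fin T → Fin T → Bool) (X : Matrix (Fin T) (Fin d) ℝ),
                (∀ i, ∃ j, a i j = true) → (∀ i, SLT.vecNorm (X i) ≤ α) →
                ∀ i, SLT.vecNorm (SLT.sourceTransformer (SLT.prune w m) a X i
                  - SLT.targetTransformer A W a X i) ≤ ε} := by
  have hq := SLT.isQuadratic_six_mul_sq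
  refine ⟨800, _, _, _, _, _, _, by norm_num, hq, hq, hq, hq, hq, hq, fun α hα => ?_⟩
  -- The propagation estimates require a token bound of at least 1, so small α is replaced by 1.
  set β : ℝ := max α 1 with hβ
  have hβ1 : 1 ≤ β := le_max_right _ _
  have hc : 210 ≤ 210 * β ^ 3 := by
    have : 1 ≤ β ^ 3 := one_le_pow₀ hβ1
    linarith
  refine ⟨210 * β ^ 3, 210 * β ^ 3, by positivity, by positivity, ?_⟩
  intro d H L B hd hH hL hB dK dV A W hA hW ε hε hε1 nMHA nFC hMHA hFC
  have hH' : (1 : ℝ) ≤ H := by exact_mod_cast hH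
  have hd' : (1 : ℝ) ≤ d := by exact_mod_cast hd
  have hL' : (1 : ℝ) ≤ L := by exact_mod_cast hL
  -- The subset sum precisions are ε/D for attention and ε/(LD) for the fully-connected layers. D
  -- dominates both the number of union-bound events and the error amplification.
  set D : ℝ := (210 * β ^ 3 * H * d) ^ (6 * B ^ 2) with hD
  have hpow : ∀ x : ℝ, x ^ (6 * (B : ℝ) ^ 2) = x ^ (6 * B ^ 2) := by
    intro x
    have h := Real.rpow_natCast x (6 * B ^ 2)
    push_cast at h
    exact h
  have hD1 : (210 * β ^ 3) ^ (6 * (B : ℝ) ^ 2) * (H : ℝ) ^ (6 * (B : ℝ) ^ 2) *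
      (d : ℝ) ^ (6 * (B : ℝ) ^ 2) = D := by
    rw [hpow, hpow, hpow, hD, ← mul_pow, ← mul_pow]
  have hevents := SLT.card_events_le hH hd (by omega : 1 ≤ B) hc
  have hampl := SLT.amplification_le hβ1 hH hd (by omega : 1 ≤ B)
  rw [← hD] at hevents hampl
  have hB' : (1 : ℝ) ≤ B := by exact_mod_cast (by omega : 1 ≤ B)
  have hD48 : 48 * d ≤ D := by
    refine le_trans ?_ hampl
    refine le_mul_of_one_le_left (by positivity) (one_le_pow₀ ?_)
    have h1 : (1 : ℝ) ≤ ((4 * H) ^ B * β) ^ 3 := one_le_pow₀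
      (one_le_mul_of_one_le_of_one_le (one_le_pow₀ (by linarith)) hβ1)
    exact one_le_mul_of_one_le_of_one_le (by linarith) h1
  have hD0 : 0 < D := by linarith
  have hDε : 48 ≤ D / ε := by
    rw [le_div_iff₀ hε]
    nlinarith
  have hLD : L * D / ε = L * (D / ε) := by ring
  have hLDε : 48 ≤ L * D / ε := by
    rw [hLD]
    nlinarith
  have hsmall : ∀ x : ℝ, 48 ≤ x → 0 < 1 / x ∧ 1 / x ≤ 1 / 4 := fun x hx =>
    ⟨by positivity, one_div_le_one_div_of_le (by norm_num) (by linarith)⟩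
  have hwMHA : ∀ b, ∃ m : ℕ, 8 * d * m ≤ nMHA b ∧ 96 * Real.log (1 / (1 / (D / ε))) ≤ m := by
    intro b
    have h := hMHA b
    simp only [hD1] at h
    rw [one_div_one_div]
    exact SLT.exists_groupSize hd (by linarith) h
  have hwFC : ∀ b, ∃ m : ℕ, 8 * d * m ≤ nFC b ∧
      96 * Real.log (1 / (1 / (L * D / ε))) ≤ m := by
    intro b
    have h := hFC b
    rw [show (210 * β ^ 3) ^ (6 * (B : ℝ) ^ 2) * L * (H : ℝ) ^ (6 * (B : ℝ) ^ 2) *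
      (d : ℝ) ^ (6 * (B : ℝ) ^ 2) = L * D by rw [← hD1]; ring] at h
    rw [one_div_one_div]
    exact SLT.exists_groupSize hd (by linarith) h
  -- At width 0 the initialisation interval would degenerate to a point and conditioning on it would
  -- not give a probability measure.
  have hnpos : ∀ b, 0 < nMHA b := by
    intro b
    obtain ⟨m, hm, hm'⟩ := hwMHA b
    rw [one_div_one_div] at hm'
    have h1 : 0 < Real.log (D / ε) := Real.log_pos (by linarith)
    have h2 : (0 : ℝ) < m := by linarith
    have h3 : 0 < m := by exact_mod_cast h2
    have h4 : 0 < 8 * d * m := by positivity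
    omega
  have hbad := SLT.measure_not_prunable_le (H := H) (L := L) (hsmall _ hDε).1 (hsmall _ hDε).2
    (hsmall _ hLDε).1 (hsmall _ hLDε).2 hnpos hwMHA hwFC
  have hbad' : SLT.initMeasure d H L B nMHA nFC
      {w | ¬ SLT.Prunable (1 / (D / ε)) (1 / (L * D / ε)) w} ≤ ENNReal.ofReal ε := by
    refine hbad.trans (ENNReal.ofReal_le_ofReal ?_)
    rw [show B * (16 * H * d ^ 2 * (1 / (D / ε)) + 8 * L * d ^ 2 * (1 / (L * D / ε))) =
      (16 * B * H * d ^ 2 + 8 * B * d ^ 2) * ε / D by field_simp, div_le_iff₀ hD0, mul_comm ε D]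
    refine mul_le_mul_of_nonneg_right (le_trans ?_ hevents) hε.le
    have : (B : ℝ) * d ^ 2 * 1 ≤ B * d ^ 2 * H := by gcongr
    linarith
  have hprob : MeasureTheory.IsProbabilityMeasure (SLT.initMeasure d H L B nMHA nFC) := by
    have : ∀ e : SLT.WeightIdx d H L B nMHA nFC, MeasureTheory.IsProbabilityMeasure
        (ProbabilityTheory.cond MeasureTheory.volume
          (Set.Icc (-SLT.initRadius e) (SLT.initRadius e))) :=
      fun e => SLT.isProbabilityMeasure_uniform (SLT.initRadius_pos hnpos e)
    unfold SLT.initMeasure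
    infer_instance
  have hgood : ENNReal.ofReal (1 - ε) ≤ SLT.initMeasure d H L B nMHA nFC
      {w | SLT.Prunable (1 / (D / ε)) (1 / (L * D / ε)) w} := by
    rw [ENNReal.ofReal_sub _ hε.le, ENNReal.ofReal_one, tsub_le_iff_right]
    -- Subadditivity suffices, so measurability of the good event is never needed.
    have h := MeasureTheory.measure_univ_le_add_compl (μ := SLT.initMeasure d H L B nMHA nFC)
      {w | SLT.Prunable (1 / (D / ε)) (1 / (L * D / ε)) w}
    rw [MeasureTheory.measure_univ] at h
    exact h.trans (add_le_add le_rfl hbad')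
  refine hgood.trans (MeasureTheory.measure_mono ?_)
  intro w hw
  obtain ⟨m, hM, hN, hUV⟩ :=
    SLT.exists_mask (hsmall _ hDε).1.le (hsmall _ hLDε).1.le hnpos hw hA hW
  refine ⟨m, fun T a X ha hX i => ?_⟩
  -- The extra factor 1/L in the fully-connected precision cancels accumulation over L layers. The
  -- contributions 16d and 32d add up to the 48d provided for in `SLT.amplification_le`.
  have hκ : 2 * L * (16 * d * (1 / (L * D / ε))) = 32 * d * (ε / D) := by field_simp; ring
  have hεD : ε / D ≤ 1 / D := div_le_div_of_nonneg_right hε1.le hD0.le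
  have hεD0 : 0 < ε / D := by positivity
  refine SLT.vecNorm_transformer_sub_le hH hA hW hM hN (by positivity) (by positivity) ?_ hUV hβ1
    hε1.le ?_ ha (fun i => (hX i).trans (le_max_left _ _)) i
  · rw [hκ]
    calc 32 * d * (ε / D) ≤ D * (1 / D) := by
          refine mul_le_mul (by linarith) hεD hεD0.le hD0.le
      _ = 1 := by field_simp
  · rw [hκ, show 16 * d * (1 / (D / ε)) + 32 * d * (ε / D) = (48 * d) * (ε / D) by
      field_simp; ring, ← mul_assoc]
    calc _ ≤ D * (ε / D) := mul_le_mul_of_nonneg_right hampl hεD0.le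
      _ = ε := by field_simp
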